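/- For each $n\in\mathbb N$ let $V$ be (the set of points of) a Poisson point process of density $n$ on the unit square with opposite sides identified (flat torus of area $1$, Euclidean distance), and, given $V$, let the anchor set $A_0\subseteq V$ be a uniformly random subset of size $m(n)$ (all of $V$ if $|V|<m(n)$). Let $\mathbf B(x,\rho)$ denote the closed disc of radius $\rho$ around $x$. In iterated localization with radio range $\rho$, $A_{t+1}=A_t\cup\{x\in V\setminus A_t: |\mathbf B(x,\rho)\cap A_t|\ge 3\}$, and all nodes are localized eventually if $A_t=V$ for some $t$. Let $0<r(n)<1$ with $r(n)\to0$, and $0<\tau(n)<\frac{r(n)}{2\sqrt2}$. Let $G$ be the virtual grid of all points $(i\frac{r}{\sqrt2},j\frac r{\sqrt2})$, $i,j\in\mathbb N$, in $[0,1)^2$, and let $q(n)$ be the probability that $\mathbf B(g,\tau)$ contains an anchor (of $A_0$) given that it contains a node of $V$; it is the same for all $g\in G$. Suppose that $$\lim_{n\to\infty}\left(1-e^{-n\pi\tau^2}\right)^{2/r^2}=1$$ and that $q(n)$ is of order at least $1/\ln(\sqrt2/r)$, i.e. for some constant $c>0$, $q(n)\ge \frac{c}{\ln(\sqrt2/r(n))}$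 for all large $n$. Then with probability tending to $1$ as $n\to\infty$ every disc $\mathbf B(g,\tau)$, $g\in G$, contains a node; and with radio range $r'=r+2\tau$, with probability tending to $1$ as $n\to\infty$ all nodes of $V$ are localized eventually. -/

import Mathlib

open MeasureTheory ProbabilityTheory Filter Topology

noncomputable section

namespace IteratedLocalization

/-- The flat unit torus, i.e. the `1 × 1` square with opposite edges identified; its `volume`
is the area measure, of total mass one. -/
abbrev Torus : Type := UnitAddCircle × UnitAddCircle

instance : IsProbabilityMeasure (volume : Measure UnitAddCircle) :=
  ⟨UnitAddCircle.measure_univ⟩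

instance : IsProbabilityMeasure (volume : Measure Torus) :=
  inferInstanceAs (IsProbabilityMeasure
    ((volume : Measure UnitAddCircle).prod (volume : Measure UnitAddCircle)))

/-- Euclidean distance on the flat torus (the metric of the product type is the maximum metric,
hence is not used). -/
def flatDist (x y : Torus) : ℝ := Real.sqrt (dist x.1 y.1 ^ 2 + dist x.2 y.2 ^ 2)

/-- The closed disc with centre `x` and radius `ρ`. -/
def disc (x : Torus) (ρ : ℝ) : Set Torus := {y | flatDist x y ≤ ρ}

/-! ### The localization process -/

/-- The set of localized nodes at time `t`, for the node set `V`, the initial set `A` and the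
radio range `ρ`: a node that is not yet localized becomes localized when at least three localized
nodes lie in its radio range. -/
def localized (ρ : ℝ) (V A : Set Torus) : ℕ → Set Torus
  | 0 => A
  | t + 1 => localized ρ V A t ∪
      {x | x ∈ V \ localized ρ V A t ∧ 3 ≤ (disc x ρ ∩ localized ρ V A t).encard}

/-- All nodes are localized eventually. -/
def AllLocalized (ρ : ℝ) (V A : Set Torus) : Prop := ∃ t, localized ρ V A t = V

/-! ### The random network -/

/-- The number of nodes together with the set of indices of the anchors. -/
structure Selection where
  /-- the number of nodes -/
  count : ℕ
  /-- the indices of the anchors -/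
  anchors : Finset ℕ

instance : MeasurableSpace Selection := ⊤

instance : DiscreteMeasurableSpace Selection := ⟨fun _ => trivial⟩

/-- A uniformly random subset of `m` of the indices `0, …, K - 1` (of all of them if `K < m`). -/
def uniformAnchors (m K : ℕ) : PMF (Finset ℕ) :=
  PMF.uniformOfFinset ((Finset.range K).powersetCard (min m K))
    (Finset.powersetCard_nonempty.2 (by simp))

/-- The number of nodes is Poisson with mean `n`; given that number, the anchors are a uniformly
random subset of size `m`. -/
def selectionLaw (n m : ℕ) : Measure Selection :=
  (poissonMeasure (n : NNReal)).bind
    fun K => ((uniformAnchors m K).map (Selection.mk K)).toMeasure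

/-- A sample: a selection, and an infinite supply of locations, of which the first `count` ones
are used. -/
abbrev Sample : Type := Selection × (ℕ → Torus)

/-- The law of the network: the locations are independent, uniform on the torus and independent of
the selection. As the number of nodes is Poisson with mean `n`, the nodes form a Poisson point
process of density `n`. -/
def networkLaw (n m : ℕ) : Measure Sample :=
  (selectionLaw n m).prod (Measure.infinitePi fun _ : ℕ => (volume : Measure Torus))

/-- The set of nodes. -/
def nodes (ω : Sample) : Set Torus := {x | ∃ i < ω.1.count, ω.2 i = x}

/-- The set of anchors. -/
def anchors (ω : Sample) : Set Torus := {x | ∃ i ∈ ω.1.anchors, ω.2 i = x}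

/-! ### The virtual grid -/

/-- The grid points `(i s, j s)` in the half-open unit square, where `s = r / √2` is the side
length of the virtual grid. -/
def virtualGrid (r : ℝ) : Set Torus :=
  {g | ∃ i j : ℕ, (i : ℝ) * (r / √2) < 1 ∧ (j : ℝ) * (r / √2) < 1 ∧
    g = (((i * (r / √2) : ℝ) : UnitAddCircle), ((j * (r / √2) : ℝ) : UnitAddCircle))}

/-- The disc of radius `τ` around `g` contains a node. -/
def occupied (τ : ℝ) (g : Torus) : Set Sample := {ω | (disc g τ ∩ nodes ω).Nonempty}

/-- The disc of radius `τ` around `g` contains an anchor. -/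
def initiallyRed (τ : ℝ) (g : Torus) : Set Sample := {ω | (disc g τ ∩ anchors ω).Nonempty}

/-- The probability that the disc of radius `τ` around `g` contains an anchor, given that it
contains a node. -/
def redProb (n m : ℕ) (τ : ℝ) (g : Torus) : ℝ :=
  (ProbabilityTheory.cond (networkLaw n m) (occupied τ g)).real (initiallyRed τ g)

end IteratedLocalization

end

/-!
Write `s = r / √2` for the side length of the virtual grid, `a = π τ²` for the area of a grid disc,
`L = log (1 / s)` and `p = exp (-n a)` for the probability that a grid disc is empty.

The hypothesis on `(1 - p) ^ (2 / r²)` says that `p / s² → 0`, so a union bound over the at most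
`(1 / s + 1)²` grid discs shows that with high probability none is empty
(`networkLaw_exists_not_occupied_le`).

Call a grid disc red if it contains a localized node at the end of the process. As `√2 s = r`, two
nodes in discs at king-move distance one are in range `r + 2 τ` of each other. If all discs are
occupied, the red discs are therefore closed under bootstrap percolation with threshold three on
the king graph, and for this rule three consecutive red cells of a row fill the whole grid
(`KingClosed.all_of_rowTriple`). Once all discs are red, every point of the torus has three disjoint
red discs in its range, also next to the seam where the grid, whose side length need not divide
`1`, does not close up (`exists_near_grid`). Hence three consecutive discs that contain anchors
localize everything (`allLocalized_of_rowTriple`).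

Such a triple exists with high probability. By the lower bound on `q`, the mean number of anchors in
a disc is at least of order `1 / L`. Conditionally on the numbers of nodes and anchors, the anchors
are independent uniform points; three disjoint batches of `B` of them, with `B a` of order `1 / L`,
are used for the first, the second and the third disc of a triple. The number of ways to choose a
triple together with one point of each batch in its respective disc has a relative variance of at
most `(1 + 1 / (B a))³ / J²`, where `J²` is the number of triples
(`infinitePi_forall_exists_not_hit_le`); this is of order `L³ s²`, which tends to zero.
-/

noncomputable section

namespace IteratedLocalization

/-! ### The flat metric -/

lemma flatDist_eq_dist (x y : Torus) :
    flatDist x y = dist (WithLp.toLp 2 x) (WithLp.toLp 2 y) := by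
  rw [WithLp.prod_dist_eq_of_L2]; rfl

lemma flatDist_triangle (x y z : Torus) : flatDist x z ≤ flatDist x y + flatDist y z := by
  simp only [flatDist_eq_dist]; exact dist_triangle _ _ _

lemma flatDist_comm (x y : Torus) : flatDist x y = flatDist y x := by
  simp only [flatDist_eq_dist]; exact dist_comm _ _

lemma dist_fst_le_flatDist (x y : Torus) : dist x.1 y.1 ≤ flatDist x y :=
  Real.le_sqrt_of_sq_le (by nlinarith [sq_nonneg (dist x.2 y.2)])

lemma dist_snd_le_flatDist (x y : Torus) : dist x.2 y.2 ≤ flatDist x y :=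
  Real.le_sqrt_of_sq_le (by nlinarith [sq_nonneg (dist x.1 y.1)])

lemma flatDist_le {x y : Torus} {a b d : ℝ} (h₁ : dist x.1 y.1 ≤ a) (h₂ : dist x.2 y.2 ≤ b)
    (hd : 0 ≤ d) (h : a ^ 2 + b ^ 2 ≤ d ^ 2) : flatDist x y ≤ d := by
  refine Real.sqrt_le_iff.2 ⟨hd, le_trans ?_ h⟩
  gcongr

/-- Two discs of radius `τ` are disjoint as soon as their centres are more than `2 τ` apart in
one of the two coordinates. -/
lemma disjoint_disc {g h : Torus} {τ : ℝ}
    (H : 2 * τ < dist g.1 h.1 ∨ 2 * τ < dist g.2 h.2) : Disjoint (disc g τ) (disc h τ) := by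
  rw [Set.disjoint_left]
  intro y (hg : flatDist g y ≤ τ) (hh : flatDist h y ≤ τ)
  rw [flatDist_comm] at hh
  have := flatDist_triangle g y h
  rcases H with H | H
  · linarith [dist_fst_le_flatDist g h]
  · linarith [dist_snd_le_flatDist g h]

lemma dist_coe_le (x y : ℝ) : dist (x : UnitAddCircle) (y : UnitAddCircle) ≤ |x - y| := by
  rw [dist_eq_norm, ← AddCircle.coe_sub, UnitAddCircle.norm_eq]
  simpa using round_le (x - y) 0

/-- The distance on the circle of two real numbers whose difference stays away from `0` and
from `1`. -/
lemma le_dist_coe {x y d : ℝ} (h₁ : d ≤ x - y) (h₂ : x - y ≤ 1 - d) :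
    d ≤ dist (x : UnitAddCircle) (y : UnitAddCircle) := by
  rw [dist_eq_norm, ← AddCircle.coe_sub, UnitAddCircle.norm_eq]
  rcases le_or_gt (round (x - y)) 0 with h | h
  · have : ((round (x - y) : ℤ) : ℝ) ≤ 0 := by exact_mod_cast h
    exact le_trans (by linarith) (le_abs_self _)
  · have : (1 : ℝ) ≤ ((round (x - y) : ℤ) : ℝ) := by exact_mod_cast h
    exact le_trans (by linarith) (neg_le_abs _)

/-! ### The localization process -/

lemma localized_mono (ρ : ℝ) (V A : Set Torus) : Monotone (localized ρ V A) :=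
  monotone_nat_of_le_succ fun _ => Set.subset_union_left

lemma localized_subset {ρ : ℝ} {V A : Set Torus} (h : A ⊆ V) (t : ℕ) : localized ρ V A t ⊆ V := by
  induction t with
  | zero => exact h
  | succ t ih => exact Set.union_subset ih fun x hx => hx.1.1

/-- On a finite node set the process stops. -/
lemma exists_localized_succ_eq {ρ : ℝ} {V A : Set Torus} (hV : V.Finite) (h : A ⊆ V) :
    ∃ t, localized ρ V A (t + 1) = localized ρ V A t := by
  by_contra! H
  have key : ∀ t, t ≤ (localized ρ V A t).ncard := by
    intro t
    induction t with
    | zero => simp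
    | succ t ih =>
      refine lt_of_le_of_lt ih (Set.ncard_lt_ncard ?_ (hV.subset (localized_subset h _)))
      exact ((localized_mono ρ V A) t.le_succ).ssubset_of_ne (H t).symm
  have h₁ := key (V.ncard + 1)
  have h₂ := Set.ncard_le_ncard (localized_subset (ρ := ρ) h (V.ncard + 1)) hV
  omega

/-- Once the process has stopped, a node with three localized nodes in its range is localized. -/
lemma mem_localized_of_three {ρ : ℝ} {V A : Set Torus} {t : ℕ}
    (ht : localized ρ V A (t + 1) = localized ρ V A t) {x : Torus} (hx : x ∈ V)
    {z : Fin 3 → Torus} (hz : Function.Injective z) (hzS : ∀ k, z k ∈ localized ρ V A t)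
    (hzx : ∀ k, flatDist x (z k) ≤ ρ) : x ∈ localized ρ V A t := by
  by_contra hxS
  refine hxS (ht ▸ Or.inr ⟨⟨hx, hxS⟩, ?_⟩)
  have hsub : Set.range z ⊆ disc x ρ ∩ localized ρ V A t := by
    rintro _ ⟨k, rfl⟩
    exact ⟨hzx k, hzS k⟩
  refine le_trans ?_ (Set.encard_le_encard hsub)
  rw [← Set.image_univ, hz.encard_image]
  simp

/-! ### Bootstrap percolation on a square grid -/

/-- `R` is closed under the rule that a cell of the `N × N` grid with three cells of `R` among
those at king-move distance at most one belongs to `R`. -/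
def KingClosed (N : ℕ) (R : ℕ → ℕ → Prop) : Prop :=
  ∀ i < N, ∀ j < N, ∀ u v : Fin 3 → ℕ, (∀ k l, k ≠ l → u k ≠ u l ∨ v k ≠ v l) →
    (∀ k, u k < N ∧ v k < N ∧ i ≤ u k + 1 ∧ u k ≤ i + 1 ∧ j ≤ v k + 1 ∧ v k ≤ j + 1 ∧
      R (u k) (v k)) → R i j

lemma KingClosed.swap {N : ℕ} {R : ℕ → ℕ → Prop} (h : KingClosed N R) :
    KingClosed N fun i j => R j i := by
  intro i hi j hj u v huv H
  refine h j hj i hi v u (fun k l hkl => (huv k l hkl).symm) fun k => ?_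
  have := H k
  tauto

lemma KingClosed.of_three {N : ℕ} {R : ℕ → ℕ → Prop} (h : KingClosed N R) {i j : ℕ} (hi : i < N)
    (hj : j < N) {a b c d e f : ℕ} (h₁ : R a b) (h₂ : R c d) (h₃ : R e f)
    (ne₁ : a ≠ c ∨ b ≠ d) (ne₂ : a ≠ e ∨ b ≠ f) (ne₃ : c ≠ e ∨ d ≠ f)
    (b₁ : a < N ∧ b < N ∧ i ≤ a + 1 ∧ a ≤ i + 1 ∧ j ≤ b + 1 ∧ b ≤ j + 1)
    (b₂ : c < N ∧ d < N ∧ i ≤ c + 1 ∧ c ≤ i + 1 ∧ j ≤ d + 1 ∧ d ≤ j + 1)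
    (b₃ : e < N ∧ f < N ∧ i ≤ e + 1 ∧ e ≤ i + 1 ∧ j ≤ f + 1 ∧ f ≤ j + 1) : R i j := by
  refine h i hi j hj ![a, c, e] ![b, d, f] ?_ ?_
  · intro k l hkl
    fin_cases k <;> fin_cases l <;> simp_all <;> omega
  · intro k
    fin_cases k
    · exact ⟨b₁.1, b₁.2.1, b₁.2.2.1, b₁.2.2.2.1, b₁.2.2.2.2.1, b₁.2.2.2.2.2, h₁⟩
    · exact ⟨b₂.1, b₂.2.1, b₂.2.2.1, b₂.2.2.2.1, b₂.2.2.2.2.1, b₂.2.2.2.2.2, h₂⟩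
    · exact ⟨b₃.1, b₃.2.1, b₃.2.2.1, b₃.2.2.2.1, b₃.2.2.2.2.1, b₃.2.2.2.2.2, h₃⟩

/-- Three consecutive cells of a row lie in `R`. -/
def RowTriple (R : ℕ → ℕ → Prop) (i j : ℕ) : Prop := R i j ∧ R (i + 1) j ∧ R (i + 2) j

/-- A row triple spreads to the two adjacent rows: first the middle cell has three neighbours
in the triple, and then each end cell has two of them and the middle cell. -/
lemma RowTriple.adjacent {N : ℕ} {R : ℕ → ℕ → Prop} (h : KingClosed N R) {i j j' : ℕ}
    (hi : i + 2 < N) (hj : j < N) (hj' : j' < N) (hjj' : j' = j + 1 ∨ j = j' + 1)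
    (H : RowTriple R i j) : RowTriple R i j' := by
  obtain ⟨h₀, h₁, h₂⟩ := H
  have hm : R (i + 1) j' := h.of_three (by omega) hj' h₀ h₁ h₂ (by omega) (by omega) (by omega)
    (by omega) (by omega) (by omega)
  exact ⟨h.of_three (by omega) hj' h₀ h₁ hm (by omega) (by omega) (by omega)
    (by omega) (by omega) (by omega), hm, h.of_three (by omega) hj' h₁ h₂ hm (by omega) (by omega)
    (by omega) (by omega) (by omega) (by omega)⟩

lemma RowTriple.all_rows {N : ℕ} {R : ℕ → ℕ → Prop} (h : KingClosed N R) {i j : ℕ}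
    (hi : i + 2 < N) (hj : j < N) (H : RowTriple R i j) {j' : ℕ} (hj' : j' < N) :
    RowTriple R i j' := by
  rcases le_total j j' with hle | hle
  · induction j', hle using Nat.le_induction with
    | base => exact H
    | succ k _ ih => exact (ih (by omega)).adjacent h hi (by omega) hj' (Or.inl rfl)
  · induction hle using Nat.decreasingInduction with
    | of_succ k hk ih => exact (ih (by omega)).adjacent h hi (by omega) hj' (Or.inr rfl)
    | self => exact H

/-- With threshold three on the king graph, three consecutive cells of a row fill the grid. -/
lemma KingClosed.all_of_rowTriple {N : ℕ} {R : ℕ → ℕ → Prop} (h : KingClosed N R) {i j : ℕ}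
    (hi : i + 2 < N) (hj : j < N) (H : RowTriple R i j) {i' j' : ℕ} (hi' : i' < N) (hj' : j' < N) :
    R i' j' := by
  have hcol : ∀ {l : ℕ}, l < N → R i l := fun hl => (H.all_rows h hi hj hl).1
  -- the column `i` is full; any of its triples fills three full rows
  obtain ⟨l, hl, hl₁, hl₂⟩ : ∃ l, l + 2 < N ∧ l ≤ j' ∧ j' ≤ l + 2 :=
    ⟨min j' (N - 3), by omega, by omega, by omega⟩
  have hT : RowTriple (fun i j => R j i) l i' :=
    RowTriple.all_rows h.swap (i := l) (j := i) hl (by omega)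
      ⟨hcol (by omega), hcol (by omega), hcol (by omega)⟩ hi'
  obtain rfl | rfl | rfl : j' = l ∨ j' = l + 1 ∨ j' = l + 2 := by omega
  exacts [hT.1, hT.2.1, hT.2.2]

/-! ### The virtual grid -/

/-- The grid point with indices `i` and `j`, for the side length `s`. -/
def gridPt (s : ℝ) (i j : ℕ) : Torus :=
  (((i * s : ℝ) : UnitAddCircle), ((j * s : ℝ) : UnitAddCircle))

lemma le_dist_grid {s : ℝ} (hs : 0 < s) {i k : ℕ} (hik : i ≠ k) (hi : ((i : ℝ) + 1) * s ≤ 1)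
    (hk : ((k : ℝ) + 1) * s ≤ 1) :
    s ≤ dist ((i * s : ℝ) : UnitAddCircle) ((k * s : ℝ) : UnitAddCircle) := by
  wlog h : k < i generalizing i k
  · rw [dist_comm]
    exact this hik.symm hk hi (by omega)
  have h' : (k : ℝ) + 1 ≤ i := by exact_mod_cast h
  refine le_dist_coe ?_ ?_
  · nlinarith
  · nlinarith [(Nat.cast_nonneg k : (0 : ℝ) ≤ k)]

lemma le_dist_grid_of_near {s : ℝ} (hs : 0 < s) (hs' : s ≤ 1 / 3) {i k : ℕ} (hik : i ≠ k)
    (h₁ : i ≤ k + 2) (h₂ : k ≤ i + 2) :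
    s ≤ dist ((i * s : ℝ) : UnitAddCircle) ((k * s : ℝ) : UnitAddCircle) := by
  wlog h : k < i generalizing i k
  · rw [dist_comm]
    exact this hik.symm h₂ h₁ (by omega)
  have h' : (k : ℝ) + 1 ≤ i := by exact_mod_cast h
  have h₁' : (i : ℝ) ≤ k + 2 := by exact_mod_cast h₁
  exact le_dist_coe (by nlinarith) (by nlinarith)

lemma dist_grid_le {s : ℝ} (hs : 0 < s) {i k : ℕ} (h₁ : i ≤ k + 1) (h₂ : k ≤ i + 1) :
    dist ((i * s : ℝ) : UnitAddCircle) ((k * s : ℝ) : UnitAddCircle) ≤ s := by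
  refine (dist_coe_le _ _).trans ?_
  have h₁' : (i : ℝ) ≤ k + 1 := by exact_mod_cast h₁
  have h₂' : (k : ℝ) ≤ i + 1 := by exact_mod_cast h₂
  rw [abs_le]
  constructor <;> nlinarith

/-- Every point of the circle has a grid point within `s / 2` and another one, more than `2 τ`
away from the first, within `s + τ`. The side length `s` need not divide the circumference, so the
last grid point and `0` may be closer than `2 τ`; in that case, for a point between these two, the
second grid point is taken on the far side of the first. -/
lemma exists_near_grid {s τ : ℝ} (hs : 0 < s) (hs' : s ≤ 1 / 3) (hτ : 0 < τ) (hτs : 2 * τ < s)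
    (u : UnitAddCircle) :
    ∃ k k' : ℕ, (k : ℝ) * s < 1 ∧ (k' : ℝ) * s < 1 ∧
      dist u ((k * s : ℝ) : UnitAddCircle) ≤ s / 2 ∧
      dist u ((k' * s : ℝ) : UnitAddCircle) ≤ s + τ ∧
      2 * τ < dist ((k * s : ℝ) : UnitAddCircle) ((k' * s : ℝ) : UnitAddCircle) := by
  obtain ⟨t, ht0, ht1, rfl⟩ : ∃ t : ℝ, 0 ≤ t ∧ t < 1 ∧ (t : UnitAddCircle) = u := by
    obtain ⟨t, ht, rfl⟩ := (AddCircle.coe_image_Ico_eq (1 : ℝ) 0).symm ▸ Set.mem_univ u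
    exact ⟨t, ht.1, by simpa using ht.2, rfl⟩
  obtain ⟨k, hk1, hk2⟩ : ∃ k : ℕ, (k : ℝ) * s ≤ t ∧ t < ((k : ℝ) + 1) * s :=
    ⟨⌊t / s⌋₊, (le_div_iff₀ hs).1 (Nat.floor_le (by positivity)),
      (div_lt_iff₀ hs).1 (Nat.lt_floor_add_one _)⟩
  have hks : 0 ≤ (k : ℝ) * s := by positivity
  have hzero : dist (t : UnitAddCircle) ((((0 : ℕ) : ℝ) * s : ℝ) : UnitAddCircle) ≤ 1 - t := by
    have : (((((0 : ℕ) : ℝ) * s : ℝ)) : UnitAddCircle) = ((1 : ℝ) : UnitAddCircle) := by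
      rw [Nat.cast_zero, zero_mul]
      exact (AddCircle.coe_period (1 : ℝ)).symm
    rw [this]
    refine (dist_coe_le _ _).trans ?_
    rw [abs_sub_comm, abs_of_nonneg (by linarith)]
  have hk : dist (t : UnitAddCircle) ((k * s : ℝ) : UnitAddCircle) ≤ t - k * s :=
    (dist_coe_le _ _).trans (by rw [abs_of_nonneg (by linarith)])
  rcases lt_or_ge (((k : ℝ) + 1) * s) 1 with hlt | hge
  · have hk' : dist (t : UnitAddCircle) (((k + 1 : ℕ) * s : ℝ) : UnitAddCircle)
        ≤ (k + 1) * s - t := (dist_coe_le _ _).trans (by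
          push_cast
          rw [abs_sub_comm, abs_of_nonneg (by linarith)])
    have hd := le_dist_grid_of_near hs hs' (i := k) (k := k + 1) (by omega) (by omega) (by omega)
    rcases le_total (t - k * s) (s / 2) with h | h
    · exact ⟨k, k + 1, by linarith, by push_cast; exact hlt, by linarith, by linarith, by linarith⟩
    · refine ⟨k + 1, k, by push_cast; exact hlt, by linarith, by linarith, by linarith, ?_⟩
      rw [dist_comm]
      linarith
  · rcases lt_or_ge (2 * τ) (1 - k * s) with hw | hw
    · have hd : 1 - k * s ≤
          dist ((k * s : ℝ) : UnitAddCircle) ((((0 : ℕ) : ℝ) * s : ℝ) : UnitAddCircle) :=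
        le_dist_coe (by push_cast; linarith) (by push_cast; linarith)
      rcases le_total (t - k * s) (s / 2) with h | h
      · exact ⟨k, 0, by linarith, by simp, by linarith, by linarith, by linarith⟩
      · refine ⟨0, k, by simp, by linarith, hzero.trans (by linarith), by linarith, ?_⟩
        rw [dist_comm]
        linarith
    · rcases le_total (t - k * s) τ with h | h
      · obtain ⟨l, rfl⟩ : ∃ l, k = l + 1 := Nat.exists_eq_succ_of_ne_zero (by
          rintro rfl
          norm_num at hge
          linarith)
        have hd := le_dist_grid_of_near hs hs' (i := l + 1) (k := l) (by omega) (by omega)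
          (by omega)
        have hl : dist (t : UnitAddCircle) ((l * s : ℝ) : UnitAddCircle) ≤ t - l * s :=
          (dist_coe_le _ _).trans (by
            push_cast at hks hk1 ⊢
            rw [abs_of_nonneg (by linarith)])
        refine ⟨l + 1, l, by linarith, ?_, by linarith, ?_, by linarith⟩
        · push_cast at hk1
          linarith
        · push_cast at h
          linarith
      · have h1 : dist (t : UnitAddCircle) ((((1 : ℕ) : ℝ) * s : ℝ) : UnitAddCircle) ≤ 1 - t + s :=
          (dist_triangle _ _ _).trans
            (add_le_add hzero (dist_grid_le hs (by omega) (by omega)))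
        have hd := le_dist_grid_of_near hs hs' (i := 0) (k := 1) (by omega) (by omega) (by omega)
        exact ⟨0, 1, by simp, by push_cast; linarith, hzero.trans (by linarith), by linarith,
          by linarith⟩

/-- The grid cells whose disc meets `S`, if `S` absorbs each node with three points of `S` in
its range `r + 2 τ`, where `r = √2 s`: a node of a disc is in range of the nodes of the discs at
king-move distance one, and these discs are disjoint. -/
lemma kingClosed_of_stable {s τ : ℝ} (hs : 0 < s) (hs' : s ≤ 1 / 3) (hτs : 2 * τ < s)
    {V S : Set Torus}
    (hS : ∀ x ∈ V, ∀ z : Fin 3 → Torus, Function.Injective z → (∀ k, z k ∈ S) →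
      (∀ k, flatDist x (z k) ≤ √2 * s + 2 * τ) → x ∈ S)
    (hocc : ∀ i j : ℕ, (i : ℝ) * s < 1 → (j : ℝ) * s < 1 →
      (disc (gridPt s i j) τ ∩ V).Nonempty) :
    KingClosed ⌈1 / s⌉₊ fun i j => (disc (gridPt s i j) τ ∩ S).Nonempty := by
  have hsqrt : √2 ^ 2 = 2 := Real.sq_sqrt (by norm_num)
  have hmem : ∀ k : ℕ, k < ⌈1 / s⌉₊ → (k : ℝ) * s < 1 := fun k hk => by
    rwa [Nat.lt_ceil, lt_div_iff₀ hs] at hk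
  intro i hi j hj u v huv H
  obtain ⟨x, hx, hxV⟩ := hocc i j (hmem i hi) (hmem j hj)
  choose z hz hzS using fun k => (H k).2.2.2.2.2.2
  refine ⟨x, hx, hS x hxV z ?_ hzS fun k => ?_⟩
  · intro k l hkl
    by_contra hne
    obtain ⟨-, -, a₁, a₂, a₃, a₄, -⟩ := H k
    obtain ⟨-, -, b₁, b₂, b₃, b₄, -⟩ := H l
    refine Set.disjoint_left.1 (disjoint_disc (g := gridPt s (u k) (v k))
      (h := gridPt s (u l) (v l)) (τ := τ) ?_) (hz k) (hkl ▸ hz l)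
    refine (huv k l hne).imp (fun h => hτs.trans_le ?_) fun h => hτs.trans_le ?_
    · exact le_dist_grid_of_near hs hs' h (by omega) (by omega)
    · exact le_dist_grid_of_near hs hs' h (by omega) (by omega)
  · obtain ⟨-, -, a₁, a₂, a₃, a₄, -⟩ := H k
    have h₁ : flatDist x (gridPt s i j) ≤ τ := by
      rw [flatDist_comm]
      exact hx
    have hsq : s ^ 2 + s ^ 2 ≤ (√2 * s) ^ 2 := by
      rw [mul_pow, hsqrt]
      linarith
    have h₂ : flatDist (gridPt s i j) (gridPt s (u k) (v k)) ≤ √2 * s :=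
      flatDist_le (dist_grid_le hs a₁ a₂) (dist_grid_le hs a₃ a₄) (by positivity) hsq
    have h₃ : flatDist (gridPt s (u k) (v k)) (z k) ≤ τ := hz k
    linarith [flatDist_triangle x (gridPt s i j) (z k),
      flatDist_triangle (gridPt s i j) (gridPt s (u k) (v k)) (z k)]

lemma exists_injective_fin_three {α : Type*} {P : α → Prop} {a b c : α} (hab : a ≠ b)
    (hac : a ≠ c) (hbc : b ≠ c) (ha : P a) (hb : P b) (hc : P c) :
    ∃ z : Fin 3 → α, Function.Injective z ∧ ∀ k, P (z k) := by
  refine ⟨![a, b, c], ?_, by simp [Fin.forall_fin_succ, ha, hb, hc]⟩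
  intro k l hkl
  fin_cases k <;> fin_cases l <;> simp_all [eq_comm]

/-- If all grid discs meet `S`, every point of the torus has three points of `S` within distance
`√2 s + 2 τ`. -/
lemma exists_three_near {s τ : ℝ} (hs : 0 < s) (hs' : s ≤ 1 / 3) (hτ : 0 < τ)
    (hτs : 2 * τ < s) {S : Set Torus}
    (hall : ∀ i j : ℕ, (i : ℝ) * s < 1 → (j : ℝ) * s < 1 →
      (disc (gridPt s i j) τ ∩ S).Nonempty) (x : Torus) :
    ∃ z : Fin 3 → Torus, Function.Injective z ∧ (∀ k, z k ∈ S) ∧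
      ∀ k, flatDist x (z k) ≤ √2 * s + 2 * τ := by
  have hsqrt : √2 ^ 2 = 2 := Real.sq_sqrt (by norm_num)
  have hsqrt1 : 1 ≤ √2 := Real.one_le_sqrt.2 (by norm_num)
  obtain ⟨k, k', hk, hk', hxk, hxk', hkk'⟩ := exists_near_grid hs hs' hτ hτs x.1
  obtain ⟨l, l', hl, hl', hxl, hxl', hll'⟩ := exists_near_grid hs hs' hτ hτs x.2
  obtain ⟨z₀, hz₀, hz₀S⟩ := hall k l hk hl
  obtain ⟨z₁, hz₁, hz₁S⟩ := hall k' l hk' hl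
  obtain ⟨z₂, hz₂, hz₂S⟩ := hall k l' hk hl'
  have d01 : Disjoint (disc (gridPt s k l) τ) (disc (gridPt s k' l) τ) :=
    disjoint_disc (Or.inl hkk')
  have d02 : Disjoint (disc (gridPt s k l) τ) (disc (gridPt s k l') τ) :=
    disjoint_disc (Or.inr hll')
  have d12 : Disjoint (disc (gridPt s k' l) τ) (disc (gridPt s k l') τ) :=
    disjoint_disc (Or.inl (hkk'.trans_eq (dist_comm _ _)))
  have h01 : z₀ ≠ z₁ := d01.ne_of_mem hz₀ hz₁
  have h02 : z₀ ≠ z₂ := d02.ne_of_mem hz₀ hz₂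
  have h12 : z₁ ≠ z₂ := d12.ne_of_mem hz₁ hz₂
  have hfar : ∀ {g z : Torus}, flatDist x g ≤ √2 * s + τ → z ∈ disc g τ →
      flatDist x z ≤ √2 * s + 2 * τ := fun {g z} hg (hz : flatDist g z ≤ τ) => by
    linarith [flatDist_triangle x g z]
  have hsq : (s / 2) ^ 2 + (s + τ) ^ 2 ≤ (√2 * s + τ) ^ 2 := by
    have h₁ : s * τ ≤ √2 * (s * τ) := le_mul_of_one_le_left (by positivity) hsqrt1
    have h₂ : (√2 * s + τ) ^ 2 = 2 * s ^ 2 + 2 * (√2 * (s * τ)) + τ ^ 2 := by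
      linear_combination s ^ 2 * hsqrt
    nlinarith [sq_nonneg s]
  have hpos : 0 ≤ √2 * s + τ := by positivity
  have hle : s / 2 ≤ s + τ := by linarith
  have f₀ : flatDist x (gridPt s k l) ≤ √2 * s + τ :=
    flatDist_le hxk (hxl.trans hle) hpos hsq
  have f₁ : flatDist x (gridPt s k' l) ≤ √2 * s + τ :=
    flatDist_le hxk' hxl hpos (by linarith only [hsq])
  have f₂ : flatDist x (gridPt s k l') ≤ √2 * s + τ := flatDist_le hxk hxl' hpos hsq
  obtain ⟨z, hz, hzP⟩ := exists_injective_fin_three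
    (P := fun z => z ∈ S ∧ flatDist x z ≤ √2 * s + 2 * τ) h01 h02 h12
    ⟨hz₀S, hfar f₀ hz₀⟩ ⟨hz₁S, hfar f₁ hz₁⟩ ⟨hz₂S, hfar f₂ hz₂⟩
  exact ⟨z, hz, fun k => (hzP k).1, fun k => (hzP k).2⟩

/-- The deterministic half of the argument: if every grid disc contains a node and three
consecutive grid discs contain an anchor, then all nodes are localized eventually. -/
theorem allLocalized_of_rowTriple {s τ : ℝ} (hs : 0 < s) (hs' : s ≤ 1 / 3) (hτ : 0 < τ)
    (hτs : 2 * τ < s) {V A : Set Torus} (hV : V.Finite) (hAV : A ⊆ V)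
    (hocc : ∀ i j : ℕ, (i : ℝ) * s < 1 → (j : ℝ) * s < 1 → (disc (gridPt s i j) τ ∩ V).Nonempty)
    {i j : ℕ} (hi : ((i : ℝ) + 2) * s < 1) (hj : (j : ℝ) * s < 1)
    (hred : RowTriple (fun i j => (disc (gridPt s i j) τ ∩ A).Nonempty) i j) :
    AllLocalized (√2 * s + 2 * τ) V A := by
  obtain ⟨t, ht⟩ := exists_localized_succ_eq (ρ := √2 * s + 2 * τ) hV hAV
  refine ⟨t, (localized_subset hAV t).antisymm ?_⟩
  have hS : ∀ x ∈ V, ∀ z : Fin 3 → Torus, Function.Injective z →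
      (∀ k, z k ∈ localized (√2 * s + 2 * τ) V A t) →
      (∀ k, flatDist x (z k) ≤ √2 * s + 2 * τ) → x ∈ localized (√2 * s + 2 * τ) V A t :=
    fun x hx z hz hzS hzx => mem_localized_of_three ht hx hz hzS hzx
  have hAS : A ⊆ localized (√2 * s + 2 * τ) V A t := localized_mono _ V A (Nat.zero_le t)
  generalize localized (√2 * s + 2 * τ) V A t = S at hS hAS
  have hmem : ∀ k : ℕ, (k : ℝ) * s < 1 → k < ⌈1 / s⌉₊ := fun k hk => by
    rwa [Nat.lt_ceil, lt_div_iff₀ hs]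
  have hall : ∀ i j : ℕ, (i : ℝ) * s < 1 → (j : ℝ) * s < 1 →
      (disc (gridPt s i j) τ ∩ S).Nonempty := fun i' j' hi' hj' =>
    (kingClosed_of_stable hs hs' hτs hS hocc).all_of_rowTriple (i := i) (j := j)
      (hmem _ (by push_cast; exact hi)) (hmem _ hj)
      ⟨hred.1.mono (Set.inter_subset_inter_right _ hAS),
        hred.2.1.mono (Set.inter_subset_inter_right _ hAS),
        hred.2.2.mono (Set.inter_subset_inter_right _ hAS)⟩ (hmem _ hi') (hmem _ hj')
  intro x hxV
  obtain ⟨z, hz, hzS, hzx⟩ := exists_three_near hs hs' hτ hτs hall x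
  exact hS x hxV z hz hzS hzx

/-! ### A second moment bound for products of counts -/

/-- Second moment bound: independent copies `ω b` of a random element enter the nonnegative
variables `∏ b, N b θ (ω b)`, whose factors have mean `μ` and, for different `θ`, are not positively
correlated. Chebyshev's inequality for the sum over `θ` bounds the probability that all these
products vanish. -/
theorem pi_prod_eq_zero_le {β Θ W : Type*} [Fintype β] [Fintype Θ] [Nonempty Θ]
    [MeasurableSpace W] (Q : Measure W) [IsProbabilityMeasure Q] (N : β → Θ → W → ℝ)
    (hN : ∀ b θ, Measurable (N b θ)) (h0 : ∀ b θ w, 0 ≤ N b θ w) {C : ℝ}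
    (hC : ∀ b θ w, N b θ w ≤ C) {μ : ℝ} (hμ : 0 < μ) (hmean : ∀ b θ, ∫ w, N b θ w ∂Q = μ)
    (hcross : ∀ b θ θ', θ ≠ θ' → ∫ w, N b θ w * N b θ' w ∂Q ≤ μ ^ 2)
    (hsq : ∀ b θ, ∫ w, N b θ w * N b θ w ∂Q ≤ μ + μ ^ 2) :
    (Measure.pi fun _ : β => Q).real {ω | ∀ θ, ∏ b, N b θ (ω b) = 0} ≤
      (1 + 1 / μ) ^ Fintype.card β / Fintype.card Θ := by
  classical
  set k := Fintype.card β
  set T : ℝ := (Fintype.card Θ : ℝ) with hT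
  have hTpos : 0 < T := by
    rw [hT]
    exact_mod_cast Fintype.card_pos
  set P := Measure.pi fun _ : β => Q
  set Z : Θ → (β → W) → ℝ := fun θ ω => ∏ b, N b θ (ω b) with hZ
  have hZmeas : ∀ θ, Measurable (Z θ) := fun θ =>
    Finset.measurable_fun_prod _ fun b _ => (hN b θ).comp (measurable_pi_apply b)
  have hZ0 : ∀ θ ω, 0 ≤ Z θ ω := fun θ ω => Finset.prod_nonneg fun b _ => h0 _ _ _
  have hZC : ∀ θ ω, Z θ ω ≤ C ^ k := fun θ ω => by
    refine (Finset.prod_le_prod (fun b _ => h0 _ _ _) fun b _ => hC b θ (ω b)).trans_eq ?_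
    simp [k]
  have hZ2 : ∀ θ, MemLp (Z θ) 2 P := fun θ =>
    MemLp.of_bound (hZmeas θ).aestronglyMeasurable (C ^ k) (ae_of_all _ fun ω => by
      rw [Real.norm_eq_abs, abs_of_nonneg (hZ0 θ ω)]
      exact hZC θ ω)
  have hZ1 : ∀ θ, Integrable (Z θ) P := fun θ => (hZ2 θ).integrable (by norm_num)
  have hZZ : ∀ θ θ', Integrable (fun ω => Z θ ω * Z θ' ω) P := fun θ θ' =>
    (hZ2 θ).integrable_mul (hZ2 θ')
  have hEZ : ∀ θ, ∫ ω, Z θ ω ∂P = μ ^ k := fun θ => by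
    rw [hZ, integral_fintype_prod_eq_prod]
    simp [hmean, k]
  have hEZZ : ∀ θ θ', ∫ ω, Z θ ω * Z θ' ω ∂P = ∏ b, ∫ w, N b θ w * N b θ' w ∂Q := fun θ θ' => by
    rw [← integral_fintype_prod_eq_prod (fun b w => N b θ w * N b θ' w)]
    simp only [hZ, Finset.prod_mul_distrib]
    rfl
  have hN0 : ∀ b θ θ', 0 ≤ ∫ w, N b θ w * N b θ' w ∂Q := fun b θ θ' =>
    integral_nonneg fun w => mul_nonneg (h0 _ _ _) (h0 _ _ _)
  set Y : (β → W) → ℝ := fun ω => ∑ θ, Z θ ω with hY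
  have hY2 : MemLp Y 2 P := memLp_finsetSum _ fun θ _ => hZ2 θ
  have hEY : ∫ ω, Y ω ∂P = T * μ ^ k := by
    rw [hY, integral_finsetSum _ fun θ _ => hZ1 θ]
    simp [hEZ, hT]
  have hEYY : ∫ ω, Y ω ^ 2 ∂P ≤ T * (μ + μ ^ 2) ^ k + (T * μ ^ k) ^ 2 := by
    have h1 : ∫ ω, Y ω ^ 2 ∂P = ∑ θ, ∑ θ', ∫ ω, Z θ ω * Z θ' ω ∂P := by
      simp only [hY, sq, Finset.sum_mul_sum]
      rw [integral_finsetSum _ fun θ _ => integrable_finsetSum _ fun θ' _ => hZZ θ θ']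
      exact Finset.sum_congr rfl fun θ _ => integral_finsetSum _ fun θ' _ => hZZ θ θ'
    have h2 : ∀ θ θ', ∫ ω, Z θ ω * Z θ' ω ∂P ≤
        (if θ = θ' then (μ + μ ^ 2) ^ k else 0) + (μ ^ 2) ^ k := fun θ θ' => by
      rw [hEZZ]
      split_ifs with h
      · subst h
        calc _ ≤ ∏ _b : β, (μ + μ ^ 2) :=
              Finset.prod_le_prod (fun b _ => hN0 _ _ _) fun b _ => hsq b θ
          _ = (μ + μ ^ 2) ^ k := by simp [k]
          _ ≤ _ := le_add_of_nonneg_right (by positivity)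
      · calc _ ≤ ∏ _b : β, μ ^ 2 :=
              Finset.prod_le_prod (fun b _ => hN0 _ _ _) fun b _ => hcross b θ θ' h
          _ = 0 + (μ ^ 2) ^ k := by simp [k]
    rw [h1]
    refine (Finset.sum_le_sum fun θ _ => Finset.sum_le_sum fun θ' _ => h2 θ θ').trans_eq ?_
    simp only [Finset.sum_add_distrib, Finset.sum_ite_eq, Finset.mem_univ, if_true,
      Finset.sum_const, Finset.card_univ, nsmul_eq_mul, ← hT]
    ring
  have hpos : 0 < T * μ ^ k := by positivity
  have hvar : Var[Y; P] ≤ T * (μ + μ ^ 2) ^ k := by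
    rw [variance_eq_sub hY2]
    simp only [Pi.pow_apply]
    rw [hEY]
    linarith
  have hcheb := meas_ge_le_variance_div_sq hY2 hpos
  rw [hEY] at hcheb
  have hsub : {ω | ∀ θ, Z θ ω = 0} ⊆ {ω | T * μ ^ k ≤ |Y ω - T * μ ^ k|} := fun ω hω => by
    have hYω : Y ω = 0 := Finset.sum_eq_zero fun θ _ => hω θ
    simp [hYω, abs_of_pos hpos]
  have hle : P.real {ω | ∀ θ, Z θ ω = 0} ≤ Var[Y; P] / (T * μ ^ k) ^ 2 :=
    ENNReal.toReal_le_of_le_ofReal (div_nonneg (variance_nonneg _ _) (sq_nonneg _))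
      ((measure_mono hsub).trans hcheb)
  refine hle.trans ?_
  calc Var[Y; P] / (T * μ ^ k) ^ 2 ≤ T * (μ + μ ^ 2) ^ k / (T * μ ^ k) ^ 2 := by gcongr
    _ = (1 + 1 / μ) ^ k / T := by
      have : 1 + 1 / μ = (μ + μ ^ 2) / μ ^ 2 := by
        field_simp
        ring
      rw [this, div_pow, pow_right_comm]
      field_simp

/-- The number of the points `w j` that lie in `D`. -/
def hitCount {X : Type*} {B : ℕ} (D : Set X) (w : Fin B → X) : ℝ :=
  ∑ j, D.indicator (fun _ => (1 : ℝ)) (w j)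

lemma indicator_one_nonneg {X : Type*} (D : Set X) (x : X) : 0 ≤ D.indicator (fun _ => (1 : ℝ)) x :=
  Set.indicator_nonneg (fun _ _ => zero_le_one) x

lemma indicator_one_le_one {X : Type*} (D : Set X) (x : X) : D.indicator (fun _ => (1 : ℝ)) x ≤ 1 :=
  Set.indicator_le_self' (fun _ _ => zero_le_one) x

lemma hitCount_nonneg {X : Type*} {B : ℕ} (D : Set X) (w : Fin B → X) : 0 ≤ hitCount D w :=
  Finset.sum_nonneg fun _ _ => indicator_one_nonneg D _

lemma hitCount_le {X : Type*} {B : ℕ} (D : Set X) (w : Fin B → X) : hitCount D w ≤ B := by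
  refine (Finset.sum_le_sum fun j _ => indicator_one_le_one D (w j)).trans_eq ?_
  simp

section HitCount

variable {X : Type*} [MeasurableSpace X] (ν : Measure X) [IsProbabilityMeasure ν] {B : ℕ}

lemma measurable_indicator_eval {D : Set X} (hD : MeasurableSet D) (j : Fin B) :
    Measurable fun w : Fin B → X => D.indicator (fun _ => (1 : ℝ)) (w j) :=
  (measurable_const.indicator hD).comp (measurable_pi_apply j)

lemma measurable_hitCount {D : Set X} (hD : MeasurableSet D) :
    Measurable (hitCount (B := B) D) :=
  Finset.measurable_fun_sum _ fun j _ => measurable_indicator_eval hD j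

lemma integrable_indicator_mul {D D' : Set X} (hD : MeasurableSet D) (hD' : MeasurableSet D')
    (i j : Fin B) :
    Integrable (fun w : Fin B → X => D.indicator (fun _ => (1 : ℝ)) (w i) *
      D'.indicator (fun _ => (1 : ℝ)) (w j)) (Measure.infinitePi fun _ : Fin B => ν) :=
  Integrable.of_bound ((measurable_indicator_eval hD i).mul
    (measurable_indicator_eval hD' j)).aestronglyMeasurable 1 (ae_of_all _ fun w => by
      rw [Real.norm_eq_abs, abs_of_nonneg
        (mul_nonneg (indicator_one_nonneg _ _) (indicator_one_nonneg _ _))]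
      exact mul_le_one₀ (indicator_one_le_one _ _) (indicator_one_nonneg _ _)
        (indicator_one_le_one _ _))

lemma integral_indicator_eval {D : Set X} (hD : MeasurableSet D) (j : Fin B) :
    ∫ w, D.indicator (fun _ => (1 : ℝ)) (w j) ∂(Measure.infinitePi fun _ : Fin B => ν) =
      ν.real D := by
  have := (measurePreserving_eval_infinitePi (fun _ : Fin B => ν) j).map_eq
  rw [← integral_map (φ := fun w : Fin B → X => w j) (f := D.indicator fun _ => (1 : ℝ))
    (measurable_pi_apply j).aemeasurable
    (measurable_const.indicator hD).aestronglyMeasurable]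
  erw [this]
  rw [integral_indicator_const _ hD]
  simp

lemma integral_indicator_eval_mul {D D' : Set X} (hD : MeasurableSet D) (hD' : MeasurableSet D')
    {i j : Fin B} (hij : i ≠ j) :
    ∫ w, D.indicator (fun _ => (1 : ℝ)) (w i) * D'.indicator (fun _ => (1 : ℝ)) (w j)
      ∂(Measure.infinitePi fun _ : Fin B => ν) = ν.real D * ν.real D' := by
  have hmap := Measure.infinitePi_map_eval_prod (P := fun _ : Fin B => ν) hij
  rw [← integral_map (φ := fun w : Fin B → X => (w i, w j))
    (f := fun p : X × X => D.indicator (fun _ => (1 : ℝ)) p.1 *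
      D'.indicator (fun _ => (1 : ℝ)) p.2) (by fun_prop)
    (((measurable_const.indicator hD).comp measurable_fst).mul
      ((measurable_const.indicator hD').comp measurable_snd)).aestronglyMeasurable, hmap,
    integral_prod_mul, integral_indicator_const _ hD, integral_indicator_const _ hD']
  simp

lemma integral_hitCount {D : Set X} (hD : MeasurableSet D) :
    ∫ w, hitCount D w ∂(Measure.infinitePi fun _ : Fin B => ν) = B * ν.real D := by
  unfold hitCount
  rw [integral_finsetSum]
  · simp [integral_indicator_eval ν hD]
  · intro j _
    exact Integrable.of_bound (measurable_indicator_eval hD j).aestronglyMeasurable 1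
      (ae_of_all _ fun w => by
        rw [Real.norm_eq_abs, abs_of_nonneg (indicator_one_nonneg _ _)]
        exact indicator_one_le_one _ _)

lemma integral_hitCount_mul {D D' : Set X} (hD : MeasurableSet D) (hD' : MeasurableSet D') :
    ∫ w, hitCount D w * hitCount D' w ∂(Measure.infinitePi fun _ : Fin B => ν) ≤
      B * ν.real (D ∩ D') + (B * ν.real D) * (B * ν.real D') := by
  classical
  unfold hitCount
  simp only [Finset.sum_mul_sum]
  rw [integral_finsetSum _ fun i _ => integrable_finsetSum _ fun j _ =>
    integrable_indicator_mul ν hD hD' i j]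
  have hterm : ∀ i j : Fin B, ∫ w, D.indicator (fun _ => (1 : ℝ)) (w i) *
      D'.indicator (fun _ => (1 : ℝ)) (w j) ∂(Measure.infinitePi fun _ : Fin B => ν) ≤
      (if i = j then ν.real (D ∩ D') else 0) + ν.real D * ν.real D' := fun i j => by
    split_ifs with h
    · subst h
      rw [← integral_indicator_eval ν (hD.inter hD') i]
      refine le_add_of_le_of_nonneg (le_of_eq ?_) (by positivity)
      refine integral_congr_ae (ae_of_all _ fun w => ?_)
      simp only [Set.indicator_apply, Set.mem_inter_iff]
      split_ifs <;> simp_all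
    · rw [integral_indicator_eval_mul ν hD hD' h, zero_add]
  calc _ ≤ ∑ i : Fin B, ∑ j : Fin B,
      ((if i = j then ν.real (D ∩ D') else 0) + ν.real D * ν.real D') := by
        refine Finset.sum_le_sum fun i _ => ?_
        rw [integral_finsetSum _ fun j _ => integrable_indicator_mul ν hD hD' i j]
        exact Finset.sum_le_sum fun j _ => hterm i j
    _ = _ := by
        simp only [Finset.sum_add_distrib, Finset.sum_ite_eq, Finset.mem_univ, if_true,
          Finset.sum_const, Finset.card_univ, Fintype.card_fin, nsmul_eq_mul]
        ring

end HitCount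

/-- Independent points of law `ν` with indices in `S`, where `S` has at least `|β| B` elements:
for each `θ` the sets `D b θ`, `b : β`, have measure `a`, and for each `b` the sets `D b θ` are
disjoint. The bound is on the probability that no `θ` has all its sets `D b θ` hit. The points of
`S` are split into `|β|` batches of size `B`, the batch `b` being used for the sets `D b θ` only;
this makes the factors of the second moment bound independent. -/
theorem infinitePi_forall_exists_not_hit_le {X β Θ : Type*} [MeasurableSpace X] (ν : Measure X)
    [IsProbabilityMeasure ν] [Fintype β] [Fintype Θ] [Nonempty Θ] {D : β → Θ → Set X}
    (hD : ∀ b θ, MeasurableSet (D b θ)) {a : ℝ} (ha : ∀ b θ, ν.real (D b θ) = a)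
    (hdisj : ∀ b θ θ', θ ≠ θ' → Disjoint (D b θ) (D b θ')) {B : ℕ} (hB : 0 < B * a)
    {S : Finset ℕ} (hS : Fintype.card β * B ≤ S.card) :
    (Measure.infinitePi fun _ : ℕ => ν) {x | ∀ θ, ∃ b, ∀ i ∈ S, x i ∉ D b θ} ≤
      ENNReal.ofReal ((1 + 1 / (B * a)) ^ Fintype.card β / Fintype.card Θ) := by
  classical
  -- an injective enumeration of the batches
  obtain ⟨e⟩ : Nonempty (β × Fin B ↪ S) :=
    Function.Embedding.nonempty_of_card_le (by simpa using hS)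
  set f : β × Fin B → ℕ := fun p => e p with hf
  have hfinj : Function.Injective f := Subtype.val_injective.comp e.injective
  set F : (ℕ → X) → β → Fin B → X := fun x b j => x (f (b, j)) with hF
  have hFmeas : Measurable F := by fun_prop
  have hmap : (Measure.infinitePi fun _ : ℕ => ν).map F =
      Measure.pi fun _ : β => Measure.infinitePi fun _ : Fin B => ν := by
    rw [← Measure.infinitePi_eq_pi, ← Measure.infinitePi_map_curry (fun (_ : β) (_ : Fin B) => ν),
      ← Measure.map_infinitePi_infinitePi_of_inj (P := fun _ : ℕ => ν) hfinj,
      Measure.map_map (by fun_prop) (by fun_prop)]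
    rfl
  set E : Set (β → Fin B → X) := {ω | ∀ θ, ∏ b, hitCount (D b θ) (ω b) = 0} with hE
  have hEmeas : MeasurableSet E := by
    rw [hE, Set.ofPred_forall]
    refine MeasurableSet.iInter fun θ => ?_
    exact (Finset.measurable_fun_prod _ fun b _ =>
      (measurable_hitCount (hD b θ)).comp (measurable_pi_apply b)) (measurableSet_singleton 0)
  have hsub : {x : ℕ → X | ∀ θ, ∃ b, ∀ i ∈ S, x i ∉ D b θ} ⊆ F ⁻¹' E := by
    intro x hx θ
    obtain ⟨b, hb⟩ := hx θ
    refine Finset.prod_eq_zero (Finset.mem_univ b) (Finset.sum_eq_zero fun j _ => ?_)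
    exact Set.indicator_of_notMem (hb _ (e (b, j)).2) _
  refine (measure_mono hsub).trans ?_
  rw [← Measure.map_apply hFmeas hEmeas, hmap, ← ofReal_measureReal]
  refine ENNReal.ofReal_le_ofReal (pi_prod_eq_zero_le _ (fun b θ => hitCount (D b θ))
    (fun b θ => measurable_hitCount (hD b θ)) (fun b θ => hitCount_nonneg _)
    (fun b θ => hitCount_le _) hB ?_ ?_ ?_)
  · intro b θ
    rw [integral_hitCount ν (hD b θ), ha]
  · intro b θ θ' h
    refine (integral_hitCount_mul ν (hD b θ) (hD b θ')).trans_eq ?_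
    rw [ha, ha, (hdisj b θ θ' h).inter_eq, measureReal_empty]
    ring
  · intro b θ
    refine (integral_hitCount_mul ν (hD b θ) (hD b θ)).trans_eq ?_
    rw [Set.inter_self, ha]
    ring

/-! ### The area of a disc -/

lemma isClosed_disc (g : Torus) (τ : ℝ) : IsClosed (disc g τ) := by
  unfold disc flatDist
  exact isClosed_le (by fun_prop) continuous_const

lemma measurableSet_disc (g : Torus) (τ : ℝ) : MeasurableSet (disc g τ) :=
  (isClosed_disc g τ).measurableSet

lemma dist_coe_eq {x y : ℝ} (h : |x - y| ≤ 1 / 2) :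
    dist (x : UnitAddCircle) (y : UnitAddCircle) = |x - y| := by
  rw [dist_eq_norm, ← AddCircle.coe_sub]
  exact (AddCircle.norm_coe_eq_abs_iff (1 : ℝ) one_ne_zero).2 (by simpa using h)

/-- A disc that does not wrap around the torus has the area of a planar disc. -/
theorem volume_disc (g : Torus) {τ : ℝ} (h0 : 0 ≤ τ) (hτ : τ < 1 / 2) :
    volume (disc g τ) = ENNReal.ofReal (Real.pi * τ ^ 2) := by
  obtain ⟨⟨a, ha⟩, ⟨b, hb⟩⟩ :=
    And.intro (QuotientAddGroup.mk_surjective g.1) (QuotientAddGroup.mk_surjective g.2)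
  -- the torus as the square of side one centred at `(a, b)`
  have hmp := (UnitAddCircle.measurePreserving_mk (a - 1 / 2)).prod
    (UnitAddCircle.measurePreserving_mk (b - 1 / 2))
  rw [Measure.prod_restrict] at hmp
  set box := Set.Ioc (a - 1 / 2) (a - 1 / 2 + 1) ×ˢ Set.Ioc (b - 1 / 2) (b - 1 / 2 + 1) with hbox
  have hpre := hmp.measure_preimage (measurableSet_disc g τ).nullMeasurableSet
  have hvol : volume (disc g τ) = ((volume : Measure UnitAddCircle).prod volume) (disc g τ) := rfl
  rw [hvol, ← hpre, Measure.restrict_apply (hmp.measurable (measurableSet_disc g τ))]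
  have hset : Prod.map ((↑) : ℝ → UnitAddCircle) ((↑) : ℝ → UnitAddCircle) ⁻¹' disc g τ ∩ box =
      Complex.measurableEquivRealProd.symm ⁻¹' Metric.closedBall (⟨a, b⟩ : ℂ) τ := by
    ext ⟨x, y⟩
    have hball : (x, y) ∈ Complex.measurableEquivRealProd.symm ⁻¹'
        Metric.closedBall (⟨a, b⟩ : ℂ) τ ↔ Real.sqrt ((x - a) ^ 2 + (y - b) ^ 2) ≤ τ := by
      simp [Complex.dist_eq_re_im]
    rw [hball]
    have hdisc : |x - a| ≤ 1 / 2 → |y - b| ≤ 1 / 2 →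
        (Prod.map ((↑) : ℝ → UnitAddCircle) ((↑) : ℝ → UnitAddCircle) (x, y) ∈ disc g τ ↔
          Real.sqrt ((x - a) ^ 2 + (y - b) ^ 2) ≤ τ) := fun hx hy => by
      have h₁ : dist g.1 (x : UnitAddCircle) = |x - a| := by
        rw [dist_comm, ← ha]
        exact dist_coe_eq hx
      have h₂ : dist g.2 (y : UnitAddCircle) = |y - b| := by
        rw [dist_comm, ← hb]
        exact dist_coe_eq hy
      change Real.sqrt (dist g.1 (x : UnitAddCircle) ^ 2 + dist g.2 (y : UnitAddCircle) ^ 2) ≤ τ ↔ _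
      rw [h₁, h₂, sq_abs, sq_abs]
    constructor
    · rintro ⟨h, ⟨hx₁, hx₂⟩, hy₁, hy₂⟩
      simp only at hx₁ hx₂ hy₁ hy₂
      exact (hdisc (abs_le.2 ⟨by linarith, by linarith⟩)
        (abs_le.2 ⟨by linarith, by linarith⟩)).1 h
    · intro h
      have h₁ : |x - a| ≤ τ := by
        refine le_trans ?_ h
        rw [← Real.sqrt_sq_eq_abs]
        exact Real.sqrt_le_sqrt (by nlinarith [sq_nonneg (y - b)])
      have h₂ : |y - b| ≤ τ := by
        refine le_trans ?_ h
        rw [← Real.sqrt_sq_eq_abs]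
        exact Real.sqrt_le_sqrt (by nlinarith [sq_nonneg (x - a)])
      refine ⟨(hdisc (by linarith) (by linarith)).2 h, ?_⟩
      rw [abs_le] at h₁ h₂
      exact ⟨⟨by simp only; linarith, by simp only; linarith⟩,
        ⟨by simp only; linarith, by simp only; linarith⟩⟩
  rw [hset]
  have := Complex.volume_preserving_equiv_real_prod.symm.measure_preimage
    (s := Metric.closedBall (⟨a, b⟩ : ℂ) τ) measurableSet_closedBall.nullMeasurableSet
  erw [this]
  rw [Complex.volume_closedBall, ENNReal.ofReal_mul Real.pi_pos.le, ENNReal.ofReal_pow h0, mul_comm,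
    ← NNReal.coe_real_pi, ENNReal.ofReal_coe_nnreal]

/-! ### The law of the network -/

/-- The law of the supply of locations. -/
abbrev locationLaw : Measure (ℕ → Torus) := Measure.infinitePi fun _ : ℕ => (volume : Measure Torus)

instance : Countable Selection :=
  Function.Injective.countable (f := fun s : Selection => (s.count, s.anchors)) fun s t h => by
    cases s
    cases t
    simp_all

instance (n m : ℕ) : IsProbabilityMeasure (selectionLaw n m) :=
  isProbabilityMeasure_bind (Measurable.of_discrete).aemeasurable
    (ae_of_all _ fun _ => inferInstance)

instance (n m : ℕ) : IsProbabilityMeasure (networkLaw n m) := by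
  unfold networkLaw
  infer_instance

lemma ae_toMeasure_map_mk (m K : ℕ) :
    ∀ᵐ s ∂((uniformAnchors m K).map (Selection.mk K)).toMeasure,
      s.count = K ∧ s.anchors ⊆ Finset.range K ∧ s.anchors.card = min m K := by
  rw [ae_iff, PMF.toMeasure_apply_eq_zero_iff _ .of_discrete, Set.disjoint_left]
  intro s hs
  rw [PMF.support_map] at hs
  obtain ⟨A, hA, rfl⟩ := hs
  rw [uniformAnchors, PMF.support_uniformOfFinset, Finset.mem_coe, Finset.mem_powersetCard] at hA
  simpa using hA

lemma lintegral_selectionLaw_count (n m : ℕ) (f : ℕ → ENNReal) :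
    ∫⁻ s, f s.count ∂selectionLaw n m = ∫⁻ K, f K ∂poissonMeasure (n : NNReal) := by
  rw [selectionLaw, Measure.lintegral_bind Measurable.of_discrete.aemeasurable
    Measurable.of_discrete.aemeasurable]
  refine lintegral_congr fun K => ?_
  have : ∫⁻ s, f s.count ∂((uniformAnchors m K).map (Selection.mk K)).toMeasure =
      ∫⁻ _, f K ∂((uniformAnchors m K).map (Selection.mk K)).toMeasure :=
    lintegral_congr_ae ((ae_toMeasure_map_mk m K).mono fun s hs => by simp only [hs.1])
  simp [this]

lemma ae_selectionLaw (n m : ℕ) : ∀ᵐ s ∂selectionLaw n m,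
    s.anchors ⊆ Finset.range s.count ∧ s.anchors.card = min m s.count := by
  rw [ae_iff, selectionLaw, Measure.bind_apply .of_discrete Measurable.of_discrete.aemeasurable,
    lintegral_eq_zero_iff Measurable.of_discrete]
  refine ae_of_all _ fun K => ?_
  refine measure_mono_null ?_ (ae_iff.1 (ae_toMeasure_map_mk m K))
  rintro s hs ⟨h₁, h₂⟩
  exact hs (by rwa [h₁])

lemma measurableSet_sample {S : Selection → Set (ℕ → Torus)} (hS : ∀ s, MeasurableSet (S s)) :
    MeasurableSet {ω : Sample | ω.2 ∈ S ω.1} := by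
  have : {ω : Sample | ω.2 ∈ S ω.1} = ⋃ s, {s} ×ˢ S s := by
    ext ω
    simp
  rw [this]
  exact MeasurableSet.iUnion fun s => (measurableSet_singleton s).prod (hS s)

/-- Conditioning on the selection. -/
lemma networkLaw_apply (n m : ℕ) {S : Selection → Set (ℕ → Torus)}
    (hS : ∀ s, MeasurableSet (S s)) :
    networkLaw n m {ω | ω.2 ∈ S ω.1} = ∫⁻ s, locationLaw (S s) ∂selectionLaw n m := by
  rw [networkLaw, Measure.prod_apply (measurableSet_sample hS)]
  rfl

/-- The generating function of the Poisson law. -/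
lemma lintegral_pow_poissonMeasure (n : ℕ) {x : ℝ} (hx : 0 ≤ x) :
    ∫⁻ K, ENNReal.ofReal x ^ K ∂poissonMeasure (n : NNReal) =
      ENNReal.ofReal (Real.exp (-(n * (1 - x)))) := by
  have hsum : HasSum (fun K : ℕ => Real.exp (-n) * ((n * x) ^ K / K.factorial))
      (Real.exp (-(n * (1 - x)))) := by
    have h := (NormedSpace.expSeries_div_hasSum_exp ((n : ℝ) * x)).mul_left (Real.exp (-n))
    rwa [← Real.exp_eq_exp_ℝ, ← Real.exp_add,
      show -(n : ℝ) + n * x = -(n * (1 - x)) by ring] at h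
  rw [poissonMeasure, lintegral_sum_measure, ← hsum.tsum_eq,
    ENNReal.ofReal_tsum_of_nonneg (fun K => by positivity) hsum.summable]
  refine tsum_congr fun K => ?_
  rw [lintegral_smul_measure, lintegral_dirac, ← ENNReal.ofReal_pow hx, smul_eq_mul,
    ← ENNReal.ofReal_mul (by positivity)]
  congr 1
  simp only [NNReal.coe_natCast, mul_pow]
  ring

/-- A Poisson variable is rarely less than half its mean. -/
lemma selectionLaw_count_lt_le (n m : ℕ) :
    selectionLaw n m {s | (s.count : ℝ) < n / 2} ≤ ENNReal.ofReal (Real.exp (-(n / 10))) := by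
  have hexp : Real.exp (-1) ≤ 2 / 5 := by
    rw [Real.exp_neg, inv_le_comm₀ (Real.exp_pos _) (by norm_num)]
    linarith [Real.exp_one_gt_d9]
  -- Markov's inequality for `exp (-K)`
  have hpt : ∀ s : Selection, Set.indicator {s : Selection | (s.count : ℝ) < n / 2}
      (fun _ => (1 : ENNReal)) s ≤ ENNReal.ofReal (Real.exp (n / 2)) *
        ENNReal.ofReal (Real.exp (-1)) ^ s.count := fun s => by
    refine Set.indicator_apply_le' (fun hs => ?_) fun _ => zero_le
    rw [← ENNReal.ofReal_pow (Real.exp_pos _).le, ← ENNReal.ofReal_mul (Real.exp_pos _).le,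
      ← Real.exp_nat_mul, ← Real.exp_add, ← ENNReal.ofReal_one]
    refine ENNReal.ofReal_le_ofReal (Real.one_le_exp ?_)
    have : (s.count : ℝ) < n / 2 := hs
    linarith
  calc selectionLaw n m {s | (s.count : ℝ) < n / 2}
      = ∫⁻ s, Set.indicator {s : Selection | (s.count : ℝ) < n / 2} (fun _ => 1) s
          ∂selectionLaw n m := (lintegral_indicator_one .of_discrete).symm
    _ ≤ ∫⁻ s, ENNReal.ofReal (Real.exp (n / 2)) * ENNReal.ofReal (Real.exp (-1)) ^ s.count
          ∂selectionLaw n m := lintegral_mono hpt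
    _ = ENNReal.ofReal (Real.exp (n / 2)) *
          ENNReal.ofReal (Real.exp (-(n * (1 - Real.exp (-1))))) := by
        rw [lintegral_const_mul _ Measurable.of_discrete, lintegral_selectionLaw_count n m
          (fun K => ENNReal.ofReal (Real.exp (-1)) ^ K),
          lintegral_pow_poissonMeasure n (Real.exp_pos _).le]
    _ ≤ _ := by
        rw [← ENNReal.ofReal_mul (Real.exp_pos _).le, ← Real.exp_add]
        refine ENNReal.ofReal_le_ofReal (Real.exp_le_exp.2 ?_)
        nlinarith [(Nat.cast_nonneg n : (0 : ℝ) ≤ n)]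

/-! ### Occupied and red discs -/

lemma compl_occupied (τ : ℝ) (g : Torus) :
    (occupied τ g)ᶜ =
      {ω : Sample | ω.2 ∈ Set.pi (Finset.range ω.1.count) fun _ => (disc g τ)ᶜ} := by
  ext ω
  simp only [occupied, nodes, Set.mem_compl_iff, Set.mem_ofPred_eq, Set.Nonempty, Set.mem_pi,
    Finset.coe_range, Set.mem_Iio, Set.mem_inter_iff, not_exists, not_and]
  constructor
  · intro h i hi hmem
    exact h _ hmem i hi rfl
  · rintro h _ hx i hi rfl
    exact h i hi hx

lemma measurableSet_pi_compl_disc (S : Finset ℕ) (g : Torus) (τ : ℝ) :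
    MeasurableSet (Set.pi (S : Set ℕ) fun _ => (disc g τ)ᶜ) :=
  MeasurableSet.pi (Finset.countable_toSet S) fun _ _ => (measurableSet_disc g τ).compl

lemma measurableSet_occupied (τ : ℝ) (g : Torus) : MeasurableSet (occupied τ g) := by
  rw [← compl_compl (occupied τ g), compl_occupied]
  exact (measurableSet_sample
    (S := fun s => Set.pi (Finset.range s.count) fun _ => (disc g τ)ᶜ)
    fun s => measurableSet_pi_compl_disc _ g τ).compl

/-- A disc is empty with probability `exp (-n π τ²)`. -/
lemma networkLaw_compl_occupied (n m : ℕ) (g : Torus) {τ : ℝ} (h0 : 0 ≤ τ) (hτ : τ < 1 / 2) :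
    networkLaw n m (occupied τ g)ᶜ = ENNReal.ofReal (Real.exp (-(n * Real.pi * τ ^ 2))) := by
  have hvol : volume (disc g τ)ᶜ = ENNReal.ofReal (1 - Real.pi * τ ^ 2) := by
    rw [prob_compl_eq_one_sub (measurableSet_disc g τ), volume_disc g h0 hτ,
      ENNReal.ofReal_sub _ (by positivity), ENNReal.ofReal_one]
  have hle : 0 ≤ 1 - Real.pi * τ ^ 2 := by nlinarith [Real.pi_lt_four, Real.pi_pos]
  rw [compl_occupied, networkLaw_apply n m
    (S := fun s => Set.pi (Finset.range s.count) fun _ => (disc g τ)ᶜ)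
    fun s => measurableSet_pi_compl_disc _ g τ]
  have hloc : ∀ s : Selection, locationLaw (Set.pi (Finset.range s.count) fun _ => (disc g τ)ᶜ) =
      ENNReal.ofReal (1 - Real.pi * τ ^ 2) ^ s.count := fun s => by
    rw [locationLaw, Measure.infinitePi_pi _ fun _ _ => (measurableSet_disc g τ).compl]
    simp [hvol]
  simp only [hloc]
  rw [lintegral_selectionLaw_count n m (fun K => ENNReal.ofReal (1 - Real.pi * τ ^ 2) ^ K),
    lintegral_pow_poissonMeasure n hle]
  congr 3
  ring

lemma networkLaw_initiallyRed_le (n m : ℕ) (g : Torus) {τ : ℝ} (h0 : 0 ≤ τ) (hτ : τ < 1 / 2) :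
    networkLaw n m (initiallyRed τ g) ≤ ENNReal.ofReal (m * (Real.pi * τ ^ 2)) := by
  have hset : initiallyRed τ g =
      {ω : Sample | ω.2 ∈ ⋃ i ∈ ω.1.anchors, (fun x : ℕ → Torus => x i) ⁻¹' disc g τ} := by
    ext ω
    simp only [initiallyRed, anchors, Set.mem_ofPred_eq, Set.Nonempty, Set.mem_inter_iff,
      Set.mem_iUnion, Set.mem_preimage, exists_prop]
    constructor
    · rintro ⟨_, hx, i, hi, rfl⟩
      exact ⟨i, hi, hx⟩
    · rintro ⟨i, hi, hx⟩
      exact ⟨_, hx, i, hi, rfl⟩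
  have hpre : ∀ i : ℕ, MeasurableSet ((fun x : ℕ → Torus => x i) ⁻¹' disc g τ) := fun i =>
    measurable_pi_apply i (measurableSet_disc g τ)
  rw [hset, networkLaw_apply n m
    (S := fun s => ⋃ i ∈ s.anchors, (fun x : ℕ → Torus => x i) ⁻¹' disc g τ)
    fun s => Finset.measurableSet_biUnion _ fun i _ => hpre i]
  have hloc : ∀ᵐ s ∂selectionLaw n m,
      locationLaw (⋃ i ∈ s.anchors, (fun x : ℕ → Torus => x i) ⁻¹' disc g τ) ≤
        ENNReal.ofReal (m * (Real.pi * τ ^ 2)) := by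
    filter_upwards [ae_selectionLaw n m] with s hs
    refine (measure_biUnion_finset_le _ _).trans ?_
    have hi : ∀ i : ℕ, locationLaw ((fun x : ℕ → Torus => x i) ⁻¹' disc g τ) =
        ENNReal.ofReal (Real.pi * τ ^ 2) := fun i => by
      rw [← volume_disc g h0 hτ]
      exact (measurePreserving_eval_infinitePi
        (fun _ : ℕ => (volume : Measure Torus)) i).measure_preimage
          (measurableSet_disc g τ).nullMeasurableSet
    simp only [hi, Finset.sum_const, nsmul_eq_mul]
    rw [ENNReal.ofReal_mul (p := (m : ℝ)) (by positivity), ENNReal.ofReal_natCast]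
    gcongr
    rw [hs.2]
    exact min_le_left _ _
  refine (lintegral_mono_ae hloc).trans_eq ?_
  simp

/-- The union bound over the anchors, in terms of the conditional probability `redProb`. -/
lemma redProb_le (n m : ℕ) (g : Torus) {τ : ℝ} (h0 : 0 ≤ τ) (hτ : τ < 1 / 2)
    (hp : Real.exp (-(n * Real.pi * τ ^ 2)) ≤ 1 / 2) :
    redProb n m τ g ≤ 2 * (m * (Real.pi * τ ^ 2)) := by
  have hocc : 1 / 2 ≤ (networkLaw n m).real (occupied τ g) := by
    have h := networkLaw_compl_occupied n m g h0 hτ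
    have h' : (networkLaw n m).real (occupied τ g)ᶜ = Real.exp (-(n * Real.pi * τ ^ 2)) := by
      rw [measureReal_def, h, ENNReal.toReal_ofReal (Real.exp_pos _).le]
    rw [probReal_compl_eq_one_sub (measurableSet_occupied τ g)] at h'
    linarith
  have hred : (networkLaw n m).real (occupied τ g ∩ initiallyRed τ g) ≤ m * (Real.pi * τ ^ 2) :=
    ENNReal.toReal_le_of_le_ofReal (by positivity)
      ((measure_mono Set.inter_subset_right).trans (networkLaw_initiallyRed_le n m g h0 hτ))
  rw [redProb, measureReal_def, cond_apply (measurableSet_occupied τ g), ENNReal.toReal_mul,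
    ENNReal.toReal_inv, ← measureReal_def, ← measureReal_def]
  refine mul_le_mul ?_ hred measureReal_nonneg zero_le_two
  rw [inv_le_comm₀ (by linarith) two_pos]
  linarith

/-- The union bound over the at most `(1 / s + 1)²` grid discs. -/
lemma networkLaw_exists_not_occupied_le (n m : ℕ) {s τ : ℝ} (hs : 0 < s) (h0 : 0 ≤ τ)
    (hτ : τ < 1 / 2) :
    networkLaw n m {ω | ∃ i j : ℕ, (i : ℝ) * s < 1 ∧ (j : ℝ) * s < 1 ∧
      ω ∉ occupied τ (gridPt s i j)} ≤
      ENNReal.ofReal ((1 / s + 1) ^ 2 * Real.exp (-(n * Real.pi * τ ^ 2))) := by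
  have hN : (⌈1 / s⌉₊ : ℝ) ≤ 1 / s + 1 := (Nat.ceil_lt_add_one (by positivity)).le
  set I := Finset.range ⌈1 / s⌉₊ ×ˢ Finset.range ⌈1 / s⌉₊
  have hsub : {ω : Sample | ∃ i j : ℕ, (i : ℝ) * s < 1 ∧ (j : ℝ) * s < 1 ∧
      ω ∉ occupied τ (gridPt s i j)} ⊆ ⋃ p ∈ I, (occupied τ (gridPt s p.1 p.2))ᶜ := by
    rintro ω ⟨i, j, hi, hj, hω⟩
    refine Set.mem_biUnion (x := (i, j)) ?_ hω
    simp only [I, Finset.coe_product, Finset.coe_range, Set.mem_prod, Set.mem_Iio, Nat.lt_ceil,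
      lt_div_iff₀ hs]
    exact ⟨hi, hj⟩
  refine (measure_mono hsub).trans ((measure_biUnion_finset_le _ _).trans ?_)
  simp only [networkLaw_compl_occupied n m _ h0 hτ, Finset.sum_const, nsmul_eq_mul]
  rw [← ENNReal.ofReal_natCast, ← ENNReal.ofReal_mul (by positivity)]
  refine ENNReal.ofReal_le_ofReal ?_
  gcongr
  simp only [I, Finset.card_product, Finset.card_range, Nat.cast_mul, sq]
  gcongr

/-- Three consecutive grid discs contain an anchor, except with small probability. Only the
`J²` triples that start in a row and a column with index below `J`, where `(J + 3) s ≤ 1`, are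
used, so that the discs do not overlap around the torus. -/
lemma networkLaw_not_rowTriple_le (n m : ℕ) {s τ : ℝ} (hs : 0 < s) (h0 : 0 < τ)
    (hτ : τ < 1 / 2) (hτs : 2 * τ < s) {J B : ℕ} (hJ : 0 < J) (hJs : ((J : ℝ) + 3) * s ≤ 1)
    (hB : 0 < B) (hBm : 3 * B ≤ m) (hBn : 3 * (B : ℝ) ≤ n / 2) :
    networkLaw n m {ω | ¬ ∃ i < J, ∃ j < J,
      RowTriple (fun i j => (disc (gridPt s i j) τ ∩ anchors ω).Nonempty) i j} ≤
      ENNReal.ofReal (Real.exp (-(n / 10)) +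
        (1 + 1 / (B * (Real.pi * τ ^ 2))) ^ 3 / (J : ℝ) ^ 2) := by
  classical
  have : NeZero J := ⟨hJ.ne'⟩
  set D : Fin 3 → Fin J × Fin J → Set Torus := fun b θ => disc (gridPt s (θ.1 + b) θ.2) τ with hD
  set S : Selection → Set (ℕ → Torus) := fun σ =>
    {x | ∀ θ, ∃ b, ∀ i ∈ σ.anchors, x i ∉ D b θ} with hS
  have hSmeas : ∀ σ, MeasurableSet (S σ) := fun σ => by
    simp only [hS, Set.ofPred_forall, Set.ofPred_exists]
    refine MeasurableSet.iInter fun θ => MeasurableSet.iUnion fun b =>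
      MeasurableSet.iInter fun i => MeasurableSet.iInter fun _ => ?_
    exact (measurable_pi_apply (X := fun _ : ℕ => Torus) i
      (measurableSet_disc (gridPt s (θ.1 + b) θ.2) τ)).compl
  have hsub : {ω : Sample | ¬ ∃ i < J, ∃ j < J,
      RowTriple (fun i j => (disc (gridPt s i j) τ ∩ anchors ω).Nonempty) i j} ⊆
      {ω | ω.2 ∈ S ω.1} := by
    intro ω hω
    by_contra hcon
    simp only [hS, Set.mem_ofPred_eq, not_forall, not_exists, not_not, exists_prop] at hcon
    obtain ⟨θ, hθ⟩ := hcon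
    have hit : ∀ b : Fin 3, (disc (gridPt s (θ.1 + b) θ.2) τ ∩ anchors ω).Nonempty := fun b => by
      obtain ⟨i, hi, hx⟩ := hθ b
      exact ⟨ω.2 i, hx, i, hi, rfl⟩
    exact hω ⟨θ.1, θ.1.2, θ.2, θ.2.2, hit 0, hit 1, hit 2⟩
  have hdisj : ∀ b θ θ', θ ≠ θ' → Disjoint (D b θ) (D b θ') := by
    intro b θ θ' hne
    have hidx : ∀ i : ℕ, i < J + 2 → ((i : ℝ) + 1) * s ≤ 1 := fun i hi => by
      have : (i : ℝ) + 1 ≤ J + 3 := by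
        have : ((i + 1 : ℕ) : ℝ) ≤ ((J + 3 : ℕ) : ℝ) := by exact_mod_cast (by omega)
        push_cast at this
        linarith
      exact (mul_le_mul_of_nonneg_right this hs.le).trans hJs
    have hb := b.2
    have h₁ := θ.1.2
    have h₂ := θ.2.2
    have h₁' := θ'.1.2
    have h₂' := θ'.2.2
    have hor : (θ.1 : ℕ) ≠ θ'.1 ∨ (θ.2 : ℕ) ≠ θ'.2 := by
      by_contra! h
      exact hne (Prod.ext (Fin.ext h.1) (Fin.ext h.2))
    refine disjoint_disc (hor.imp (fun h => hτs.trans_le ?_) fun h => hτs.trans_le ?_)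
    · exact le_dist_grid hs (by omega) (hidx _ (by omega)) (hidx _ (by omega))
    · exact le_dist_grid hs h (hidx _ (by omega)) (hidx _ (by omega))
  have hBa : 0 < (B : ℝ) * (Real.pi * τ ^ 2) := by
    have : (0 : ℝ) < B := by exact_mod_cast hB
    have := Real.pi_pos
    positivity
  have hvol : ∀ b θ, (volume : Measure Torus).real (D b θ) = Real.pi * τ ^ 2 := fun b θ => by
    rw [measureReal_def, hD, volume_disc _ h0.le hτ, ENNReal.toReal_ofReal]
    have := Real.pi_pos
    positivity
  set ε : ENNReal := ENNReal.ofReal ((1 + 1 / (B * (Real.pi * τ ^ 2))) ^ 3 / (J : ℝ) ^ 2) with hε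
  have hloc : ∀ᵐ σ ∂selectionLaw n m, locationLaw (S σ) ≤
      Set.indicator {σ : Selection | (σ.count : ℝ) < n / 2} (fun _ => 1) σ + ε := by
    filter_upwards [ae_selectionLaw n m] with σ hσ
    by_cases hc : (σ.count : ℝ) < n / 2
    · rw [Set.indicator_of_mem (show σ ∈ {σ : Selection | (σ.count : ℝ) < n / 2} from hc)]
      exact prob_le_one.trans le_self_add
    · refine le_add_of_nonneg_of_le zero_le ?_
      have hcount : 3 * B ≤ σ.count := by
        have : ((3 * B : ℕ) : ℝ) ≤ σ.count := by
          push_cast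
          linarith
        exact_mod_cast this
      have hcard : Fintype.card (Fin 3) * B ≤ σ.anchors.card := by
        rw [hσ.2, Fintype.card_fin]
        exact le_min hBm hcount
      refine (infinitePi_forall_exists_not_hit_le (volume : Measure Torus)
        (fun b θ => measurableSet_disc _ τ) hvol hdisj hBa hcard).trans_eq ?_
      simp [hε, sq]
  calc _ ≤ networkLaw n m {ω | ω.2 ∈ S ω.1} := measure_mono hsub
    _ = ∫⁻ σ, locationLaw (S σ) ∂selectionLaw n m := networkLaw_apply n m hSmeas
    _ ≤ ∫⁻ σ, (Set.indicator {σ : Selection | (σ.count : ℝ) < n / 2} (fun _ => 1) σ + ε)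
          ∂selectionLaw n m := lintegral_mono_ae hloc
    _ = selectionLaw n m {σ : Selection | (σ.count : ℝ) < n / 2} + ε := by
        rw [lintegral_add_left Measurable.of_discrete]
        congr 1
        · exact lintegral_indicator_one .of_discrete
        · simp
    _ ≤ ENNReal.ofReal (Real.exp (-(n / 10))) + ε := by
        gcongr
        exact selectionLaw_count_lt_le n m
    _ = _ := by
        rw [hε, ENNReal.ofReal_add (Real.exp_pos _).le (by positivity)]

/-! ### Asymptotics -/

/-- An outer measure of the complements that tends to zero suffices: the sets `A n` need not be
measurable. -/
lemma tendsto_measure_one {Ω : Type*} [MeasurableSpace Ω] {μ : ℕ → Measure Ω}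
    [∀ n, IsProbabilityMeasure (μ n)] {A : ℕ → Set Ω} {ε : ℕ → ℝ} (hε : Tendsto ε atTop (𝓝 0))
    (h : ∀ᶠ n in atTop, μ n (A n)ᶜ ≤ ENNReal.ofReal (ε n)) :
    Tendsto (fun n => μ n (A n)) atTop (𝓝 1) := by
  have hlim : Tendsto (fun n => 1 - ENNReal.ofReal (ε n)) atTop (𝓝 1) := by
    have h1 := ENNReal.Tendsto.sub (tendsto_const_nhds (x := (1 : ENNReal)) (f := atTop))
      (ENNReal.tendsto_ofReal hε) (Or.inl ENNReal.one_ne_top)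
    simpa using h1
  refine tendsto_of_tendsto_of_tendsto_of_le_of_le' hlim tendsto_const_nhds ?_
    (Eventually.of_forall fun n => prob_le_one)
  filter_upwards [h] with n hn
  refine tsub_le_iff_right.2 ?_
  calc (1 : ENNReal) = μ n (A n ∪ (A n)ᶜ) := by rw [Set.union_compl_self, measure_univ]
    _ ≤ μ n (A n) + μ n (A n)ᶜ := measure_union_le _ _
    _ ≤ _ := by gcongr

lemma tendsto_mul_of_one_sub_rpow {p x : ℕ → ℝ} (hp : ∀ᶠ n in atTop, 0 ≤ p n ∧ p n < 1)
    (hx : ∀ n, 0 ≤ x n) (h : Tendsto (fun n => (1 - p n) ^ x n) atTop (𝓝 1)) :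
    Tendsto (fun n => x n * p n) atTop (𝓝 0) := by
  have hlog : Tendsto (fun n => -Real.log ((1 - p n) ^ x n)) atTop (𝓝 0) := by
    simpa using (h.log one_ne_zero).neg
  refine tendsto_of_tendsto_of_tendsto_of_le_of_le' tendsto_const_nhds hlog ?_ ?_
  · filter_upwards [hp] with n hn
    exact mul_nonneg (hx n) hn.1
  · filter_upwards [hp] with n hn
    have hpos : 0 < 1 - p n := by linarith [hn.2]
    rw [Real.log_rpow hpos, ← mul_neg]
    refine mul_le_mul_of_nonneg_left ?_ (hx n)
    linarith [Real.log_le_sub_one_of_pos hpos]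

lemma nodes_finite (ω : Sample) : (nodes ω).Finite := by
  refine ((Set.finite_Iio ω.1.count).image ω.2).subset ?_
  rintro x ⟨i, hi, rfl⟩
  exact ⟨i, hi, rfl⟩

/-- The probability that some node is never localized, for fixed parameters. -/
lemma networkLaw_not_allLocalized_le (n m : ℕ) {s τ : ℝ} (hs : 0 < s) (hs' : s ≤ 1 / 3)
    (h0 : 0 < τ) (hτs : 2 * τ < s) {J B : ℕ} (hJ : 0 < J) (hJs : ((J : ℝ) + 3) * s ≤ 1)
    (hB : 0 < B) (hBm : 3 * B ≤ m) (hBn : 3 * (B : ℝ) ≤ n / 2) :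
    networkLaw n m {ω | AllLocalized (√2 * s + 2 * τ) (nodes ω) (anchors ω)}ᶜ ≤
      ENNReal.ofReal ((1 / s + 1) ^ 2 * Real.exp (-(n * Real.pi * τ ^ 2)) +
        (Real.exp (-(n / 10)) + (1 + 1 / (B * (Real.pi * τ ^ 2))) ^ 3 / (J : ℝ) ^ 2)) := by
  have hτ : τ < 1 / 2 := by linarith
  have hae : networkLaw n m {ω | ¬ ω.1.anchors ⊆ Finset.range ω.1.count} = 0 := by
    have h := (Measure.quasiMeasurePreserving_fst (μ := selectionLaw n m)
      (ν := locationLaw)).ae (ae_selectionLaw n m)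
    exact ae_iff.1 (h.mono fun ω hω => hω.1)
  have hsub : {ω : Sample | AllLocalized (√2 * s + 2 * τ) (nodes ω) (anchors ω)}ᶜ ⊆
      {ω | ∃ i j : ℕ, (i : ℝ) * s < 1 ∧ (j : ℝ) * s < 1 ∧ ω ∉ occupied τ (gridPt s i j)} ∪
      ({ω | ¬ ∃ i < J, ∃ j < J,
        RowTriple (fun i j => (disc (gridPt s i j) τ ∩ anchors ω).Nonempty) i j} ∪
        {ω | ¬ ω.1.anchors ⊆ Finset.range ω.1.count}) := by
    intro ω hω
    by_contra hcon
    simp only [Set.mem_union, not_or, Set.mem_ofPred_eq, not_not] at hcon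
    obtain ⟨hocc, ⟨i, hi, j, hj, hT⟩, hA⟩ := hcon
    push Not at hocc
    have hi' : (i : ℝ) + 1 ≤ J := by exact_mod_cast hi
    have hj' : (j : ℝ) + 1 ≤ J := by exact_mod_cast hj
    refine hω (allLocalized_of_rowTriple hs hs' h0 hτs (nodes_finite ω) ?_ hocc
      (lt_of_lt_of_le ?_ hJs) (lt_of_lt_of_le ?_ hJs) hT)
    · rintro x ⟨k, hk, rfl⟩
      exact ⟨k, Finset.mem_range.1 (hA hk), rfl⟩
    · exact mul_lt_mul_of_pos_right (by linarith) hs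
    · exact mul_lt_mul_of_pos_right (by linarith) hs
  have hpi := Real.pi_pos
  have hJ' : (0 : ℝ) < J := by exact_mod_cast hJ
  rw [ENNReal.ofReal_add (by positivity) (by positivity)]
  refine (measure_mono hsub).trans ((measure_union_le _ _).trans (add_le_add
    (networkLaw_exists_not_occupied_le n m hs h0.le hτ) ((measure_union_le _ _).trans ?_)))
  rw [hae, add_zero]
  exact networkLaw_not_rowTriple_le n m hs h0 hτ hτs hJ hJs hB hBm hBn

/-- The choice of the batch size `B`, of order `1 / (a L)` where `L = log (1 / s)` and `a = π τ²` is
the area of a grid disc, and of the number `J` of rows and columns, of order `1 / s`. -/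
lemma exists_batch_size {n m : ℕ} {s τ c q : ℝ} (hs : 0 < s) (hs' : s ≤ 1 / 8) (h0 : 0 < τ)
    (hτs : 2 * τ < s) (hc : 0 < c) (hL1 : 1 ≤ Real.log (1 / s)) (hcs : 6 * s ≤ c)
    (hcL : c ≤ Real.log (1 / s)) (hp : 1 ≤ n * Real.pi * τ ^ 2)
    (hq : c / Real.log (1 / s) ≤ q) (hqm : q ≤ 2 * (m * (Real.pi * τ ^ 2))) :
    ∃ J B : ℕ, 0 < J ∧ ((J : ℝ) + 3) * s ≤ 1 ∧ 0 < B ∧ 3 * B ≤ m ∧ 3 * (B : ℝ) ≤ n / 2 ∧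
      (1 + 1 / (B * (Real.pi * τ ^ 2))) ^ 3 / (J : ℝ) ^ 2 ≤
        4 * (1 + 12 / c) ^ 3 * (Real.log (1 / s) ^ 3 / (1 / s)) := by
  have hpi := Real.pi_pos
  set L := Real.log (1 / s)
  set a := Real.pi * τ ^ 2 with ha
  have hLpos : 0 < L := by linarith
  have hapos : 0 < a := by positivity
  have has : a ≤ s ^ 2 := by
    have : τ ^ 2 ≤ s ^ 2 / 4 := by nlinarith
    have h4 := Real.pi_lt_four
    calc a ≤ 4 * (s ^ 2 / 4) := mul_le_mul h4.le this (by positivity) (by norm_num)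
      _ = s ^ 2 := by ring
  have hLs : L * s ≤ 1 := by
    have h1 : L ≤ 1 / s - 1 := Real.log_le_sub_one_of_pos (by positivity)
    have h2 : (1 / s) * s = 1 := by field_simp
    nlinarith
  set x := c / (6 * L * a) with hx
  have hxpos : 0 < x := by positivity
  have hx1 : 1 ≤ x := by
    rw [hx, one_le_div (by positivity)]
    calc 6 * L * a ≤ 6 * L * s ^ 2 := by gcongr
      _ = 6 * s * (L * s) := by ring
      _ ≤ 6 * s * 1 := by gcongr
      _ ≤ c := by linarith
  have hxa : x * a = c / (6 * L) := by
    rw [hx]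
    field_simp
  have hBx : (⌊x⌋₊ : ℝ) ≤ x := Nat.floor_le hxpos.le
  have hxB : x / 2 ≤ ⌊x⌋₊ := by
    have h1 : x < ⌊x⌋₊ + 1 := Nat.lt_floor_add_one x
    have h2 : (1 : ℝ) ≤ ⌊x⌋₊ := by exact_mod_cast Nat.one_le_floor_iff x |>.2 hx1
    linarith
  have hcL6 : 3 * (c / (6 * L)) = c / L / 2 := by
    field_simp
    norm_num
  have hJfloor : (⌊1 / s⌋₊ : ℝ) ≤ 1 / s := Nat.floor_le (by positivity)
  have hJfloor' : 1 / s < ⌊1 / s⌋₊ + 1 := Nat.lt_floor_add_one _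
  have h8 : 8 ≤ 1 / s := by
    rw [le_div_iff₀ hs]
    linarith
  have h8' : 8 ≤ ⌊1 / s⌋₊ := Nat.le_floor (by exact_mod_cast h8)
  have hJ : ((⌊1 / s⌋₊ - 3 : ℕ) : ℝ) = ⌊1 / s⌋₊ - 3 := by
    rw [Nat.cast_sub (by omega)]
    norm_num
  have hJle : 1 / s / 2 ≤ ((⌊1 / s⌋₊ - 3 : ℕ) : ℝ) := by
    rw [hJ]
    linarith
  refine ⟨⌊1 / s⌋₊ - 3, ⌊x⌋₊, by omega, ?_, Nat.floor_pos.2 hx1, ?_, ?_, ?_⟩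
  · rw [hJ, sub_add_cancel, ← le_div_iff₀ hs]
    exact hJfloor
  · have h1 : 3 * x * a ≤ m * a := by
      rw [mul_assoc, hxa, hcL6]
      linarith
    have h2 : 3 * x ≤ m := le_of_mul_le_mul_right h1 hapos
    have h3 : ((3 * ⌊x⌋₊ : ℕ) : ℝ) ≤ m := by
      push_cast
      linarith
    exact_mod_cast h3
  · have h1 : 3 * x * a ≤ n / 2 * a := by
      have : c / L ≤ 1 := (div_le_one hLpos).2 hcL
      have hna : (n : ℝ) / 2 * a = n * Real.pi * τ ^ 2 / 2 := by
        rw [ha]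
        ring
      rw [mul_assoc, hxa, hcL6, hna]
      linarith
    have h2 : 3 * x ≤ n / 2 := le_of_mul_le_mul_right h1 hapos
    linarith
  · have hμ : c / (12 * L) ≤ ⌊x⌋₊ * a := by
      calc c / (12 * L) = x / 2 * a := by
            rw [div_mul_eq_mul_div, hxa]
            field_simp
            norm_num
        _ ≤ _ := by gcongr
    have hinv : 1 + 1 / (⌊x⌋₊ * a) ≤ (1 + 12 / c) * L := by
      calc 1 + 1 / (⌊x⌋₊ * a) ≤ 1 + 1 / (c / (12 * L)) := by gcongr
        _ = 1 + 12 / c * L := by field_simp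
        _ ≤ (1 + 12 / c) * L := by linarith
    have hxpos' : 0 < (⌊x⌋₊ : ℝ) := by linarith
    calc (1 + 1 / (⌊x⌋₊ * a)) ^ 3 / ((⌊1 / s⌋₊ - 3 : ℕ) : ℝ) ^ 2
        ≤ ((1 + 12 / c) * L) ^ 3 / (1 / s / 2) ^ 2 := by gcongr
      _ = 4 * (1 + 12 / c) ^ 3 * (L ^ 3 / (1 / s)) * s := by
          field_simp
          norm_num
      _ ≤ 4 * (1 + 12 / c) ^ 3 * (L ^ 3 / (1 / s)) * 1 := by
          gcongr
          linarith
      _ = _ := mul_one _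

end IteratedLocalization

end

theorem theorem3 (r τ : ℕ → ℝ) (m : ℕ → ℕ)
    (hr : ∀ n, 0 < r n ∧ r n < 1)
    (hr0 : Tendsto r atTop (𝓝 0))
    (hτ : ∀ n, 0 < τ n ∧ τ n < r n / (2 * √2))
    (hE : Tendsto (fun n : ℕ =>
        (1 - Real.exp (-((n : ℝ) * Real.pi * τ n ^ 2))) ^ (2 / r n ^ 2 : ℝ)) atTop (𝓝 1))
    (c : ℝ) (hc : 0 < c)
    (hq : ∀ᶠ n in atTop, ∀ g ∈ IteratedLocalization.virtualGrid (r n),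
        c / Real.log (√2 / r n) ≤ IteratedLocalization.redProb n (m n) (τ n) g) :
    Tendsto (fun n => IteratedLocalization.networkLaw n (m n)
        {ω | ∀ g ∈ IteratedLocalization.virtualGrid (r n),
          ω ∈ IteratedLocalization.occupied (τ n) g}) atTop (𝓝 1) ∧
    Tendsto (fun n => IteratedLocalization.networkLaw n (m n)
        {ω | IteratedLocalization.AllLocalized (r n + 2 * τ n)
          (IteratedLocalization.nodes ω) (IteratedLocalization.anchors ω)}) atTop (𝓝 1) := by
  open IteratedLocalization in
  have hsqrt : (0 : ℝ) < √2 := by positivity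
  have hsqrt2 : √2 ^ 2 = 2 := Real.sq_sqrt (by norm_num)
  obtain ⟨s, hs⟩ : ∃ s : ℕ → ℝ, ∀ n, s n = r n / √2 := ⟨_, fun _ => rfl⟩
  have hrs : ∀ n, r n = √2 * s n := fun n => by
    rw [hs]
    field_simp
  have hspos : ∀ n, 0 < s n := fun n => by
    rw [hs]
    exact div_pos (hr n).1 hsqrt
  have hs1 : ∀ n, s n < 1 := fun n => by
    rw [hs, div_lt_one hsqrt]
    exact (hr n).2.trans_le (Real.one_le_sqrt.2 (by norm_num))
  have hτs : ∀ n, 2 * τ n < s n := fun n => by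
    have h := (hτ n).2
    rw [hs]
    calc 2 * τ n < 2 * (r n / (2 * √2)) := by linarith
      _ = r n / √2 := by field_simp
  have hs0 : Tendsto s atTop (𝓝 0) := by
    have h := hr0.div_const √2
    rw [zero_div] at h
    exact h.congr fun n => (hs n).symm
  have hexponent : ∀ n, 2 / r n ^ 2 = (1 / s n) ^ 2 := fun n => by
    rw [hrs, mul_pow, hsqrt2]
    have := (hspos n).ne'
    field_simp
  set p : ℕ → ℝ := fun n => Real.exp (-((n : ℝ) * Real.pi * τ n ^ 2)) with hp
  -- the expected number of empty grid discs tends to zero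
  have hsp : Tendsto (fun n => (1 / s n) ^ 2 * p n) atTop (𝓝 0) := by
    have h := tendsto_mul_of_one_sub_rpow (p := p) (x := fun n => 2 / r n ^ 2) ?_
      (fun n => by positivity) hE
    · simpa only [hexponent] using h
    · filter_upwards [eventually_gt_atTop 0] with n hn
      have hn' : (0 : ℝ) < n := by exact_mod_cast hn
      have := (hτ n).1
      have := Real.pi_pos
      exact ⟨(Real.exp_pos _).le, Real.exp_lt_one_iff.2 (neg_lt_zero.2 (by positivity))⟩
  have hempty : Tendsto (fun n => (1 / s n + 1) ^ 2 * p n) atTop (𝓝 0) := by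
    have hsp4 := hsp.const_mul 4
    rw [mul_zero] at hsp4
    refine squeeze_zero (fun n => by positivity) (fun n => ?_) hsp4
    have h1 : 1 ≤ 1 / s n := by
      rw [le_div_iff₀ (hspos n)]
      linarith [hs1 n]
    have h2 : (1 / s n + 1) ^ 2 ≤ 4 * (1 / s n) ^ 2 := by nlinarith
    rw [← mul_assoc]
    exact mul_le_mul_of_nonneg_right h2 (Real.exp_pos _).le
  have hτhalf : ∀ n, τ n < 1 / 2 := fun n => by linarith [hτs n, hs1 n]
  refine ⟨tendsto_measure_one hempty (Eventually.of_forall fun n => ?_), ?_⟩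
  · refine (measure_mono ?_).trans (networkLaw_exists_not_occupied_le n (m n) (hspos n)
      (hτ n).1.le (hτhalf n))
    intro ω hω
    simp only [Set.mem_compl_iff, Set.mem_ofPred_eq, not_forall] at hω
    obtain ⟨_, ⟨i, j, hi, hj, rfl⟩, hg⟩ := hω
    rw [← hs] at hi hj hg
    exact ⟨i, j, hi, hj, hg⟩
  have hinv : Tendsto (fun n => 1 / s n) atTop atTop := by
    simp only [one_div]
    exact (tendsto_nhdsWithin_iff.2 ⟨hs0, Eventually.of_forall hspos⟩).inv_tendsto_nhdsGT_zero
  have hL : Tendsto (fun n => Real.log (1 / s n)) atTop atTop := Real.tendsto_log_atTop.comp hinv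
  have hLs : Tendsto (fun n => 4 * (1 + 12 / c) ^ 3 * (Real.log (1 / s n) ^ 3 / (1 / s n)))
      atTop (𝓝 0) := by
    have h := (Real.tendsto_pow_log_div_mul_add_atTop 1 0 3 one_ne_zero).comp hinv
    simpa [Function.comp_def] using h.const_mul (4 * (1 + 12 / c) ^ 3)
  have hn10 : Tendsto (fun n : ℕ => Real.exp (-((n : ℝ) / 10))) atTop (𝓝 0) :=
    Real.tendsto_exp_neg_atTop_nhds_zero.comp
      (tendsto_natCast_atTop_atTop.atTop_div_const (by norm_num))
  have hp0 : Tendsto p atTop (𝓝 0) := by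
    refine squeeze_zero (fun n => (Real.exp_pos _).le) (fun n => ?_) hempty
    have h1 : 0 < 1 / s n := by
      have := hspos n
      positivity
    exact le_mul_of_one_le_left (Real.exp_pos _).le (by nlinarith)
  have herr := hempty.add (hn10.add hLs)
  rw [add_zero, add_zero] at herr
  refine tendsto_measure_one herr ?_
  filter_upwards [hq, hs0.eventually_le_const (u := 1 / 8) (by norm_num),
    hs0.eventually_le_const (u := c / 6) (by positivity), hL.eventually_ge_atTop 1,
    hL.eventually_ge_atTop c, hp0.eventually_le_const (Real.exp_pos (-1)),
    hp0.eventually_le_const (u := 1 / 2) (by norm_num)]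
    with n hqn hs8 hsc hL1 hLc hpe hp2
  have hlog : √2 / r n = 1 / s n := by
    rw [hs, one_div_div]
  have hgrid : gridPt (s n) 0 0 ∈ virtualGrid (r n) :=
    ⟨0, 0, by simp, by simp, by rw [← hs]; rfl⟩
  obtain ⟨J, B, hJ, hJs, hB, hBm, hBn, hbound⟩ := exists_batch_size (n := n) (m := m n)
    (hspos n) hs8 (hτ n).1 (hτs n) hc hL1 (by linarith) hLc
    (by linarith [Real.exp_le_exp.1 hpe]) (hlog ▸ hqn _ hgrid)
    (redProb_le n (m n) _ (hτ n).1.le (hτhalf n) hp2)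
  rw [hrs]
  refine (networkLaw_not_allLocalized_le n (m n) (hspos n) (by linarith) (hτ n).1 (hτs n) hJ hJs
    hB hBm hBn).trans (ENNReal.ofReal_le_ofReal ?_)
  gcongr
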